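/- Let $G=(V,c)$ be a countably infinite weighted graph: $V$ is countably infinite and $c:V\times V\to[0,\infty)$ satisfies $c(x,y)=c(y,x)$ and $c(x,x)=0$; $x,y$ are adjacent if $c(x,y)>0$. Assume that $G$ is connected and that $c_x:=\sum_{y}c(x,y)<\infty$ for all $x\in V$. Let $\mathcal E(u,v)=\frac12\sum_{x,y\in V}c(x,y)(u(x)-u(y))(v(x)-v(y))$ and $\mathcal E(u)=\mathcal E(u,u)$. Let $\operatorname{dom}\mathcal E$ be the set of all $u:V\to\mathbb R$ with $\mathcal E(u)<\infty$, and let $\mathcal Fin$ be the set of all $u:V\to\mathbb R$ that are constant outside a finite set. For $\mathcal D\subseteq\operatorname{dom}\mathcal E$ put $$R_{\mathcal D}(x,y)=\left(\inf\{\mathcal E(u): u\in\mathcal D,\ u(x)=1,\ u(y)=0\}\right)^{-1}\quad(x\ne y),\qquad R_{\mathcal D}(x,x)=0 .$$ $(\mathcal E,\mathcal D)$ is a *resistance form* (Kigami) if: $\mathcal D$ is a linear space containing the constants, on which $\mathcal E$ is a non-negative symmetric bilinear form vanishing exactly on the constants; $\mathcal D$ modulo constants is complete for $\mathcal E$; every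 real function on a finite subset of $V$ extends to an element of $\mathcal D$; $\sup\{|u(p)-u(q)|^2/\mathcal E(u):u\in\mathcal D,\ \mathcal E(u)>0\}<\infty$ for all $p,q\in V$; and for $u\in\mathcal D$ the function $\bar u=\min\{1,\max\{u,0\}\}$ lies in $\mathcal D$ and satisfies $\mathcal E(\bar u)\le\mathcal E(u)$. For a finite connected weighted graph, the effective resistance between $x$ and $y$ is $\phi(x)$, where $\phi$ is the solution of $\Delta\phi=\frac1{c_x}\mathbf 1_x-\frac1{c_y}\mathbf 1_y$, $\phi(y)=0$, with $(\Delta f)(z)=f(z)-\sum_w\frac{c(z,w)}{c_z}f(w)$. A *finite exhaustion* of $V$ is an increasing sequence of finite non-empty sets $V_n$ with union $V$. A graph $(V,c')$ is the *limit graph* of $R:V\times V\to\mathbb R$ if, for every finite exhaustion $(V_n)$, there is for each $n$ exactly one connected weighted graph $(V_n,c_n)$ with effective resistance $R|_{V_n\times V_n}$, and $c_n(x,y)\to c'(x,y)$ for all $x,y\in V$. Then: 1. If $\mathcal Fin\subseteq\mathcal D\subseteq\operatorname{dom}\mathcal E$ and $(\mathcal E,\mathcal D)$ is a resistance form, then $G$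 is the limit graph of $R_{\mathcal D}$. 2. Let $R^F(x,y)$ be the free effective resistance of $G$, that is, the limit of the effective resistances between $x$ and $y$ in the subgraphs of $G$ induced on $V_n$, along any finite exhaustion with connected induced subgraphs. This limit exists and $R^F=R_{\operatorname{dom}\mathcal E}$; moreover $\mathcal Fin\subseteq\operatorname{dom}\mathcal E$ and $(\mathcal E,\operatorname{dom}\mathcal E)$ is a resistance form, and $G$ is the limit graph of $R^F$. 3. Let $R^W(x,y)$ be the wired effective resistance of $G$, defined in the same way but with $V\setminus V_n$ identified to a single additional vertex (without loops) instead of deleted. This limit exists and $R^W=R_{\mathcal Fin}$; moreover $R^W=R_{\mathcal D}$ for some $\mathcal D$ with $\mathcal Fin\subseteq\mathcal D\subseteq\operatorname{dom}\mathcal E$ such that $(\mathcal E,\mathcal D)$ is a resistance form, and $G$ is the limit graph of $R^W$. -/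

import Mathlib

open Filter Topology

/-- A weighted graph on the vertex set `V`: a symmetric non-negative weight function vanishing on
the diagonal. Two vertices are adjacent when their weight is positive. -/
@[ext]
structure WeightedGraph (V : Type*) where
  c : V → V → ℝ
  nonneg : ∀ x y, 0 ≤ c x y
  symm : ∀ x y, c x y = c y x
  diag : ∀ x, c x x = 0

namespace WeightedGraph

variable {V : Type*}

/-- The underlying simple graph: `x` and `y` are adjacent iff `c x y > 0`. -/
def toSimpleGraph (G : WeightedGraph V) : SimpleGraph V where
  Adj x y := 0 < G.c x y
  symm := ⟨fun x y h => by rw [G.symm y x]; exact h⟩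
  loopless := ⟨fun x h => by rw [G.diag x] at h; exact lt_irrefl 0 h⟩

/-- Connectedness (this includes that there is at least one vertex). -/
def Connected (G : WeightedGraph V) : Prop := G.toSimpleGraph.Connected

/-- Local finiteness in the sense of finite total weight at each vertex. -/
def LocallyFinite (G : WeightedGraph V) : Prop := ∀ x, Summable (G.c x)

/-- The total weight `c_x` at the vertex `x`. -/
noncomputable def totalWeight (G : WeightedGraph V) (x : V) : ℝ := ∑' y, G.c x y

/-- The normalized Laplacian `(Δ f)(x) = f x - ∑ y, c(x,y) / c_x * f y`. -/
noncomputable def laplacian (G : WeightedGraph V) (f : V → ℝ) (x : V) : ℝ :=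
  f x - ∑' y, G.c x y / G.totalWeight x * f y

open Classical in
/-- `φ` solves the discrete Dirichlet problem `Δ φ = 1_x / c_x - 1_y / c_y`, `φ y = 0`. -/
def IsDirichletSolution (G : WeightedGraph V) (x y : V) (φ : V → ℝ) : Prop :=
  (∀ z, G.laplacian φ z =
    (if z = x then 1 / G.totalWeight x else 0) - (if z = y then 1 / G.totalWeight y else 0)) ∧
  φ y = 0

open Classical in
/-- The effective resistance between `x` and `y` in a finite connected graph: `φ x`, where `φ` is
the solution of the Dirichlet problem (it exists and is unique in such a graph). The value is `0`
if there is no solution. -/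
noncomputable def effectiveResistance (G : WeightedGraph V) (x y : V) : ℝ :=
  if h : ∃ φ, G.IsDirichletSolution x y φ then h.choose x else 0

/-- The (polarized) energy form
`E(u,v) = 1/2 * ∑ x y, c(x,y) (u x - u y) (v x - v y)`; it is used on functions of finite energy,
where the series converges absolutely. -/
noncomputable def energyForm (G : WeightedGraph V) (u v : V → ℝ) : ℝ :=
  1 / 2 * ∑' p : V × V, G.c p.1 p.2 * (u p.1 - u p.2) * (v p.1 - v p.2)

/-- `dom E`: the functions of finite energy (the energy is a series of non-negative terms). -/
def domE (G : WeightedGraph V) : Set (V → ℝ) :=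
  {u | Summable fun p : V × V => G.c p.1 p.2 * (u p.1 - u p.2) ^ 2}

/-- The subgraph induced on a finite set of vertices. -/
def induce (G : WeightedGraph V) (W : Finset V) : WeightedGraph W where
  c x y := G.c x y
  nonneg x y := G.nonneg x y
  symm x y := G.symm x y
  diag x := G.diag x

/-- The weights of the wired graph on a finite set `W` of vertices: the vertices outside `W` are
identified to the single vertex `none`, and loops at that vertex are removed. -/
noncomputable def wiredWeight (G : WeightedGraph V) (W : Finset V) :
    Option W → Option W → ℝ
  | some x, some y => G.c x y
  | some x, none => ∑' z : {z : V // z ∉ W}, G.c x z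
  | none, some y => ∑' z : {z : V // z ∉ W}, G.c y z
  | none, none => 0

/-- The wired graph on a finite set `W` of vertices. -/
noncomputable def wire (G : WeightedGraph V) (W : Finset V) : WeightedGraph (Option W) where
  c := G.wiredWeight W
  nonneg x y := by
    rcases x with _ | x <;> rcases y with _ | y
    · exact le_refl 0
    · exact tsum_nonneg fun z => G.nonneg _ _
    · exact tsum_nonneg fun z => G.nonneg _ _
    · exact G.nonneg _ _
  symm x y := by
    rcases x with _ | x <;> rcases y with _ | y
    · rfl
    · rfl
    · rfl
    · exact G.symm _ _
  diag x := by
    rcases x with _ | x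
    · rfl
    · exact G.diag _

end WeightedGraph

/-- `Fin`: the functions that are constant outside a finite set. -/
def finiteFunctions (V : Type*) : Set (V → ℝ) :=
  {u | ∃ k : ℝ, ∃ W : Finset V, ∀ x, x ∉ W → u x = k}

/-- Resistance forms `(E, F)` on a set `X`, in the sense of Kigami. Only the values of `E` on `F`
matter. -/
structure IsResistanceForm {X : Type*} (E : (X → ℝ) → (X → ℝ) → ℝ) (F : Set (X → ℝ)) : Prop where
  /-- (RF1) `F` is a linear space of functions containing the constants, and `E` is a non-negative
  symmetric bilinear form on `F` which vanishes exactly on the constants. -/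
  const_mem : ∀ k : ℝ, (fun _ => k) ∈ F
  add_mem : ∀ u ∈ F, ∀ v ∈ F, u + v ∈ F
  smul_mem : ∀ a : ℝ, ∀ u ∈ F, a • u ∈ F
  map_add : ∀ u ∈ F, ∀ v ∈ F, ∀ w ∈ F, E (u + v) w = E u w + E v w
  map_smul : ∀ a : ℝ, ∀ u ∈ F, ∀ v ∈ F, E (a • u) v = a * E u v
  map_symm : ∀ u ∈ F, ∀ v ∈ F, E u v = E v u
  map_nonneg : ∀ u ∈ F, 0 ≤ E u u
  map_eq_zero_iff : ∀ u ∈ F, (E u u = 0 ↔ ∃ k : ℝ, ∀ x, u x = k)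
  /-- (RF2) The quotient of `F` by the constants, with inner product `E`, is complete. -/
  complete : ∀ u : ℕ → X → ℝ, (∀ n, u n ∈ F) →
    (∀ ε > 0, ∃ N, ∀ m ≥ N, ∀ n ≥ N, E (u m - u n) (u m - u n) < ε) →
    ∃ v ∈ F, Tendsto (fun n => E (u n - v) (u n - v)) atTop (𝓝 0)
  /-- (RF3) Every function on a finite set extends to an element of `F`. -/
  extend : ∀ (W : Finset X) (v : X → ℝ), ∃ u ∈ F, ∀ x ∈ W, u x = v x
  /-- (RF4) For all points `p`, `q`, the supremum of `|u p - u q|² / E(u,u)` over the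
  non-constant `u` in `F` is finite. -/
  bounded : ∀ p q : X, ∃ C : ℝ, ∀ u ∈ F, (u p - u q) ^ 2 ≤ C * E u u
  /-- (RF5) The Markov property. -/
  markov : ∀ u ∈ F, (fun x => min 1 (max (u x) 0)) ∈ F ∧
    E (fun x => min 1 (max (u x) 0)) (fun x => min 1 (max (u x) 0)) ≤ E u u

/-- `R(x,y) = (inf {E(u,u) | u ∈ F, u x = 1, u y = 0})⁻¹`. For `x = y` the infimum runs over the
empty set, and the value is `0`. -/
noncomputable def resistance {X : Type*} (E : (X → ℝ) → (X → ℝ) → ℝ) (F : Set (X → ℝ))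
    (x y : X) : ℝ :=
  (sInf {r : ℝ | ∃ u ∈ F, u x = 1 ∧ u y = 0 ∧ r = E u u})⁻¹

/-- A finite exhaustion: an increasing sequence of finite sets whose union is everything. -/
def IsFiniteExhaustion {V : Type*} (W : ℕ → Finset V) : Prop :=
  Monotone W ∧ ∀ x, ∃ n, x ∈ W n

/-- `K` is a connected graph on the finite set `W` whose effective resistance is the restriction
of `R` to `W`. -/
def RepresentsOn {V : Type*} (R : V → V → ℝ) (W : Finset V) (K : WeightedGraph W) : Prop :=
  K.Connected ∧ ∀ x y : W, K.effectiveResistance x y = R x y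

open Classical in
/-- `H` is the limit graph of `R`: for every exhaustion by finite non-empty sets `W n` there is,
for each `n`, exactly one connected graph `K n` on `W n` with effective resistance `R` restricted
to `W n`, and the edge weights of the graphs `K n` converge to those of `H`. -/
def IsLimitGraph {V : Type*} (R : V → V → ℝ) (H : WeightedGraph V) : Prop :=
  ∀ W : ℕ → Finset V, IsFiniteExhaustion W → (∀ n, (W n).Nonempty) →
    ∃ K : ∀ n, WeightedGraph (W n),
      (∀ n, RepresentsOn R (W n) (K n) ∧ ∀ K₀, RepresentsOn R (W n) K₀ → K₀ = K n) ∧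
      ∀ x y, Tendsto
        (fun n => if h : x ∈ W n ∧ y ∈ W n then (K n).c ⟨x, h.1⟩ ⟨y, h.2⟩ else 0)
        atTop (𝓝 (H.c x y))

open Classical in
/-- `R` is the free effective resistance of `G`: along every exhaustion by finite sets inducing
connected subgraphs, the effective resistances of the induced subgraphs converge to `R`. -/
def IsFreeEffectiveResistance {V : Type*} (G : WeightedGraph V) (R : V → V → ℝ) : Prop :=
  ∀ W : ℕ → Finset V, IsFiniteExhaustion W → (∀ n, (G.induce (W n)).Connected) →
    ∀ x y, Tendsto
      (fun n => if h : x ∈ W n ∧ y ∈ W n then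
        (G.induce (W n)).effectiveResistance ⟨x, h.1⟩ ⟨y, h.2⟩ else 0)
      atTop (𝓝 (R x y))

open Classical in
/-- `R` is the wired effective resistance of `G`: along every exhaustion by finite sets inducing
connected subgraphs, the effective resistances of the wired graphs converge to `R`. -/
def IsWiredEffectiveResistance {V : Type*} (G : WeightedGraph V) (R : V → V → ℝ) : Prop :=
  ∀ W : ℕ → Finset V, IsFiniteExhaustion W → (∀ n, (G.induce (W n)).Connected) →
    ∀ x y, Tendsto
      (fun n => if h : x ∈ W n ∧ y ∈ W n then
        (G.wire (W n)).effectiveResistance (some ⟨x, h.1⟩) (some ⟨y, h.2⟩) else 0)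
      atTop (𝓝 (R x y))

/-! Statement 1 rests on traces. For a finite non-empty set $W$, let $\eta_x$ be the function in
$\mathcal D$ of least energy that equals $\mathbf 1_x$ on $W$. It is orthogonal to every function in
$\mathcal D$ vanishing on $W$, and the Markov property gives $0\le\eta_x\le1$. The numbers
$-\mathcal E(\eta_x,\eta_y)$, $x\ne y$, are the weights of a connected graph on $W$ whose energy is
that of the harmonic extension, so its effective resistance is $R_{\mathcal D}$ (`exists_trace`). It
is the only such graph, because resistances determine the potentials by polarization and the
potentials invert the Laplacian (`eq_of_effectiveResistance_eq`). Since $\eta_y-\mathbf 1_y$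
vanishes on $W$, the weight equals $\sum_z c(y,z)\eta_x(z)$. As $W$ grows, $\eta_x\to\mathbf 1_x$
pointwise, and dominated convergence with majorant $c(y,\cdot)$ gives the limit $c(x,y)$
(`isLimitGraph_resistance`).

For statement 2, $\operatorname{dom}\mathcal E$ is complete by a Fatou argument. Near-minimizers on
the induced subgraphs, truncated to $[0,1]$, have pointwise limits by compactness, and Fatou again
shows that the minimal energies on $V_n$ cannot stay below that on $V$.

For statement 3, functions on the wired graph are the functions constant off $V_n$, with the same
energy, which yields $R_{\mathcal Fin}$. As $\mathcal Fin$ need not be complete, it is replaced by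
its energy closure `finClosure`. This leaves the infima unchanged (`sInf_energies_finiteFunctions`)
and is a resistance form; the delicate axiom is the Markov property, which follows from the
continuity of truncation in energy (`tendsto_energyForm_clamp_sub`). -/

/-! ### Truncation to the unit interval -/

section Clamp

variable {X : Type*}

/-- The truncation of a function to the unit interval. -/
def clamp (u : X → ℝ) : X → ℝ := fun x => min 1 (max (u x) 0)

theorem clamp_mem_Icc (u : X → ℝ) (x : X) : clamp u x ∈ Set.Icc (0 : ℝ) 1 :=
  ⟨le_min zero_le_one (le_max_right _ _), min_le_left _ _⟩

theorem clamp_of_mem_Icc {u : X → ℝ} {x : X} (h : u x ∈ Set.Icc (0 : ℝ) 1) :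
    clamp u x = u x := by
  rw [clamp, max_eq_left h.1, min_eq_right h.2]

theorem clamp_sub_sq_le (u : X → ℝ) (x y : X) :
    (clamp u x - clamp u y) ^ 2 ≤ (u x - u y) ^ 2 := by
  rw [sq_le_sq]
  refine (abs_min_sub_min_le_max 1 _ 1 _).trans ?_
  simp only [sub_self, abs_zero]
  refine max_le (abs_nonneg _) ((abs_max_sub_max_le_max _ _ _ _).trans ?_)
  simp

end Clamp

/-! ### The energy form on functions of finite energy -/

namespace WeightedGraph

variable {V : Type*} {G : WeightedGraph V}

theorem summable_energy_mul {u v : V → ℝ} (hu : u ∈ G.domE) (hv : v ∈ G.domE) :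
    Summable fun p : V × V => G.c p.1 p.2 * (u p.1 - u p.2) * (v p.1 - v p.2) := by
  refine Summable.of_norm_bounded (Summable.add hu hv) fun p => ?_
  rw [Real.norm_eq_abs, abs_le]
  have := G.nonneg p.1 p.2
  constructor <;> nlinarith [mul_nonneg this (sq_nonneg ((u p.1 - u p.2) + (v p.1 - v p.2))),
    mul_nonneg this (sq_nonneg ((u p.1 - u p.2) - (v p.1 - v p.2))),
    mul_nonneg this (sq_nonneg (u p.1 - u p.2)), mul_nonneg this (sq_nonneg (v p.1 - v p.2))]

theorem energyForm_self (u : V → ℝ) :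
    G.energyForm u u = 1 / 2 * ∑' p : V × V, G.c p.1 p.2 * (u p.1 - u p.2) ^ 2 := by
  simp only [energyForm, mul_assoc, sq]

theorem energyForm_comm (u v : V → ℝ) : G.energyForm u v = G.energyForm v u := by
  simp only [energyForm]
  congr 2
  ext p
  ring

theorem energy_term_nonneg (u : V → ℝ) (p : V × V) :
    0 ≤ G.c p.1 p.2 * (u p.1 - u p.2) ^ 2 :=
  mul_nonneg (G.nonneg _ _) (sq_nonneg _)

theorem energyForm_self_nonneg (u : V → ℝ) : 0 ≤ G.energyForm u u := by
  rw [energyForm_self]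
  exact mul_nonneg (by norm_num) (tsum_nonneg fun p => energy_term_nonneg u p)

theorem const_mem_domE (k : ℝ) : (fun _ => k) ∈ G.domE := by
  simp [domE, summable_zero]

theorem add_mem_domE {u v : V → ℝ} (hu : u ∈ G.domE) (hv : v ∈ G.domE) : u + v ∈ G.domE := by
  have := (Summable.add hu hv).add ((summable_energy_mul hu hv).mul_left 2)
  refine this.congr fun p => ?_
  simp only [Pi.add_apply]
  ring

theorem smul_mem_domE (a : ℝ) {u : V → ℝ} (hu : u ∈ G.domE) : a • u ∈ G.domE := by
  refine (Summable.mul_left (a ^ 2) hu).congr fun p => ?_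
  simp only [Pi.smul_apply, smul_eq_mul]
  ring

theorem sub_mem_domE {u v : V → ℝ} (hu : u ∈ G.domE) (hv : v ∈ G.domE) : u - v ∈ G.domE := by
  have := add_mem_domE hu (smul_mem_domE (-1) hv)
  rwa [neg_one_smul, ← sub_eq_add_neg] at this

theorem energyForm_add_left {u v w : V → ℝ} (hu : u ∈ G.domE) (hv : v ∈ G.domE)
    (hw : w ∈ G.domE) :
    G.energyForm (u + v) w = G.energyForm u w + G.energyForm v w := by
  simp only [energyForm]
  rw [← mul_add, ← (summable_energy_mul hu hw).tsum_add (summable_energy_mul hv hw)]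
  congr 2
  ext p
  simp only [Pi.add_apply]
  ring

theorem energyForm_smul_left (a : ℝ) (u v : V → ℝ) :
    G.energyForm (a • u) v = a * G.energyForm u v := by
  simp only [energyForm]
  rw [mul_left_comm, ← tsum_mul_left (a := a)]
  refine congrArg _ (tsum_congr fun p => ?_)
  simp only [Pi.smul_apply, smul_eq_mul]
  ring

theorem sum_le_two_mul_energyForm {u : V → ℝ} (hu : u ∈ G.domE) (S : Finset (V × V)) :
    ∑ p ∈ S, G.c p.1 p.2 * (u p.1 - u p.2) ^ 2 ≤ 2 * G.energyForm u u := by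
  rw [energyForm_self]
  have := Summable.sum_le_tsum S (fun p _ => energy_term_nonneg (G := G) u p) hu
  linarith

theorem term_le_two_mul_energyForm {u : V → ℝ} (hu : u ∈ G.domE) (x y : V) :
    G.c x y * (u x - u y) ^ 2 ≤ 2 * G.energyForm u u := by
  simpa using sum_le_two_mul_energyForm hu {(x, y)}

/-- A function whose partial energy sums are bounded has finite energy, with the same bound. -/
theorem mem_domE_of_sum_le {u : V → ℝ} {a : ℝ}
    (h : ∀ S : Finset (V × V), ∑ p ∈ S, G.c p.1 p.2 * (u p.1 - u p.2) ^ 2 ≤ 2 * a) :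
    u ∈ G.domE ∧ G.energyForm u u ≤ a := by
  have hs : u ∈ G.domE := summable_of_sum_le (fun p => energy_term_nonneg u p) h
  refine ⟨hs, ?_⟩
  rw [energyForm_self]
  have := Summable.tsum_le_of_sum_le hs h
  linarith

/-- Induction along a walk from $p$ to $q$: an edge $ab$ costs $2/c(a,b)$, and $(s+t)^2\le2s^2+2t^2$
joins it to the rest. -/
theorem exists_sq_sub_le (hconn : G.Connected) (p q : V) :
    ∃ C : ℝ, ∀ u ∈ G.domE, (u p - u q) ^ 2 ≤ C * G.energyForm u u := by
  obtain ⟨w⟩ := hconn.preconnected p q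
  induction w with
  | nil => exact ⟨0, fun u _ => by simp⟩
  | @cons a b d hab _ ih =>
    obtain ⟨C, hC⟩ := ih
    have hc : 0 < G.c a b := hab
    refine ⟨2 * (2 / G.c a b) + 2 * C, fun u hu => ?_⟩
    have h1 : (u a - u b) ^ 2 ≤ 2 / G.c a b * G.energyForm u u := by
      rw [div_mul_eq_mul_div, le_div_iff₀ hc, mul_comm]
      exact term_le_two_mul_energyForm hu a b
    nlinarith [hC u hu, sq_nonneg ((u a - u b) - (u b - u d))]

theorem energyForm_const (k : ℝ) : G.energyForm (fun _ => k) (fun _ => k) = 0 := by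
  simp [energyForm]

theorem eq_const_of_energyForm_eq_zero (hconn : G.Connected) {u : V → ℝ} (hu : u ∈ G.domE)
    (h : G.energyForm u u = 0) (x y : V) : u x = u y := by
  obtain ⟨C, hC⟩ := exists_sq_sub_le hconn x y
  have := hC u hu
  rw [h, mul_zero] at this
  have := pow_eq_zero_iff (two_ne_zero) |>.1 (le_antisymm this (sq_nonneg _))
  linarith

theorem clamp_term_le (u : V → ℝ) (p : V × V) :
    G.c p.1 p.2 * (clamp u p.1 - clamp u p.2) ^ 2 ≤ G.c p.1 p.2 * (u p.1 - u p.2) ^ 2 :=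
  mul_le_mul_of_nonneg_left (clamp_sub_sq_le u _ _) (G.nonneg _ _)

theorem clamp_mem_domE {u : V → ℝ} (hu : u ∈ G.domE) : clamp u ∈ G.domE :=
  Summable.of_nonneg_of_le (fun p => energy_term_nonneg _ p) (clamp_term_le u) hu

theorem energyForm_clamp_le {u : V → ℝ} (hu : u ∈ G.domE) :
    G.energyForm (clamp u) (clamp u) ≤ G.energyForm u u := by
  rw [energyForm_self, energyForm_self]
  exact mul_le_mul_of_nonneg_left
    (Summable.tsum_le_tsum (clamp_term_le u) (clamp_mem_domE hu) hu) (by norm_num)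

/-- The energy terms of a point mass at `y` live on row `y` and column `y` of `V × V`; this lemma
and the next sum one of each. -/
theorem hasSum_fst_eq [DecidableEq V] {f : V → ℝ} {a : ℝ} (y : V) (hf : HasSum f a) :
    HasSum (fun p : V × V => if p.1 = y then f p.2 else 0) a := by
  refine ((Prod.mk_right_injective y).hasSum_iff ?_).1 (by simpa [Function.comp_def] using hf)
  rintro ⟨b, d⟩ h
  refine if_neg fun e => h ⟨d, ?_⟩
  simp only at e
  rw [e]

theorem hasSum_snd_eq [DecidableEq V] {f : V → ℝ} {a : ℝ} (y : V) (hf : HasSum f a) :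
    HasSum (fun p : V × V => if p.2 = y then f p.1 else 0) a := by
  refine ((Prod.mk_left_injective y).hasSum_iff ?_).1 (by simpa [Function.comp_def] using hf)
  rintro ⟨b, d⟩ h
  refine if_neg fun e => h ⟨b, ?_⟩
  simp only at e
  rw [e]

theorem single_mem_domE [DecidableEq V] (hfin : G.LocallyFinite) (y : V) :
    (Pi.single y 1 : V → ℝ) ∈ G.domE := by
  have h := (hasSum_fst_eq y (hfin y).hasSum).summable.add
    (hasSum_snd_eq y (hfin y).hasSum).summable
  refine Summable.of_nonneg_of_le (fun p => energy_term_nonneg _ p) (fun p => ?_) h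
  obtain ⟨a, b⟩ := p
  have h1 := G.nonneg y a
  have h2 := G.nonneg y b
  have h3 := G.symm y a
  by_cases ha : a = y <;> by_cases hb : b = y <;> simp_all [G.diag]

/-- The energy pairing with a point mass. -/
theorem energyForm_single [DecidableEq V] {u : V → ℝ} {y : V} {a : ℝ}
    (h : HasSum (fun z => G.c y z * (u y - u z)) a) :
    G.energyForm u (Pi.single y 1) = a := by
  have h' := (hasSum_fst_eq y h).add (hasSum_snd_eq y h)
  have e : (fun p : V × V => G.c p.1 p.2 * (u p.1 - u p.2) *
      ((Pi.single y 1 : V → ℝ) p.1 - (Pi.single y 1 : V → ℝ) p.2)) =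
      fun p : V × V => (if p.1 = y then G.c y p.2 * (u y - u p.2) else 0) +
        (if p.2 = y then G.c y p.1 * (u y - u p.1) else 0) := by
    ext ⟨a, b⟩
    have h3 := G.symm y a
    by_cases ha : a = y <;> by_cases hb : b = y <;> simp_all [G.diag]
    ring
  rw [energyForm, e, h'.tsum_eq]
  ring

theorem finiteFunctions_subset_domE (hfin : G.LocallyFinite) : finiteFunctions V ⊆ G.domE := by
  classical
  rintro u ⟨k, W, hu⟩
  have e : u = (fun _ => k) + ∑ y ∈ W, (u y - k) • (Pi.single y 1 : V → ℝ) := by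
    ext x
    simp only [Pi.add_apply, Finset.sum_apply, Pi.smul_apply, Pi.single_apply, smul_eq_mul,
      mul_ite, mul_one, mul_zero, Finset.sum_ite_eq]
    split_ifs with hx
    · ring
    · rw [hu x hx, add_zero]
  rw [e]
  refine add_mem_domE (const_mem_domE k) ?_
  refine Finset.sum_induction _ (· ∈ G.domE) (fun a b => add_mem_domE) (const_mem_domE 0)
    fun y _ => smul_mem_domE _ (single_mem_domE hfin y)

/-- Normalized at a base point `o`, the sequence is pointwise Cauchy by `exists_sq_sub_le`. Its
pointwise limit is the energy limit by Fatou's lemma, carried out on finite partial sums. -/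
theorem domE_complete (hconn : G.Connected) (u : ℕ → V → ℝ) (hu : ∀ n, u n ∈ G.domE)
    (hc : ∀ ε > 0, ∃ N, ∀ m ≥ N, ∀ n ≥ N, G.energyForm (u m - u n) (u m - u n) < ε) :
    ∃ v ∈ G.domE, Tendsto (fun n => G.energyForm (u n - v) (u n - v)) atTop (𝓝 0) := by
  obtain ⟨o⟩ := hconn.nonempty
  have hcau : ∀ x, CauchySeq fun n => u n x - u n o := by
    intro x
    obtain ⟨C, hC⟩ := exists_sq_sub_le hconn x o
    rw [Metric.cauchySeq_iff]
    intro ε hε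
    obtain ⟨N, hN⟩ := hc (ε ^ 2 / (|C| + 1)) (by positivity)
    refine ⟨N, fun m hm n hn => ?_⟩
    have h1 := hC _ (sub_mem_domE (hu m) (hu n))
    have h2 := hN m hm n hn
    rw [lt_div_iff₀ (by positivity)] at h2
    have h3 := energyForm_self_nonneg (G := G) (u m - u n)
    rw [Real.dist_eq]
    refine abs_lt_of_sq_lt_sq ?_ hε.le
    simp only [Pi.sub_apply] at h1
    nlinarith [le_abs_self C]
  choose v hv using fun x => cauchySeq_tendsto_of_complete (hcau x)
  have key : ∀ ε > 0, ∃ N, ∀ n ≥ N, u n - v ∈ G.domE ∧ G.energyForm (u n - v) (u n - v) ≤ ε := by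
    intro ε hε
    obtain ⟨N, hN⟩ := hc ε hε
    refine ⟨N, fun n hn => mem_domE_of_sum_le fun S => ?_⟩
    -- The normalizing constants `u m o` cancel in the differences, so these are partial energy sums
    -- of `u n - u m`.
    have ht : Tendsto (fun m => ∑ p ∈ S, G.c p.1 p.2 *
        ((u n p.1 - (u m p.1 - u m o)) - (u n p.2 - (u m p.2 - u m o))) ^ 2) atTop
        (𝓝 (∑ p ∈ S, G.c p.1 p.2 * ((u n - v) p.1 - (u n - v) p.2) ^ 2)) := by
      refine tendsto_finsetSum _ fun p _ => ?_
      exact ((((tendsto_const_nhds.sub (hv p.1)).sub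
        (tendsto_const_nhds.sub (hv p.2))).pow 2).const_mul _)
    refine le_of_tendsto ht ?_
    filter_upwards [eventually_ge_atTop N] with m hm
    have := sum_le_two_mul_energyForm (sub_mem_domE (hu n) (hu m)) S
    have h2 := hN n hn m hm
    refine le_trans (le_of_eq ?_) (this.trans (by linarith))
    refine Finset.sum_congr rfl fun p _ => ?_
    simp only [Pi.sub_apply]
    ring
  have hvm : v ∈ G.domE := by
    obtain ⟨N, hN⟩ := key 1 one_pos
    have := sub_mem_domE (hu N) (hN N le_rfl).1
    rwa [sub_sub_cancel] at this
  refine ⟨v, hvm, ?_⟩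
  rw [Metric.tendsto_atTop]
  intro ε hε
  obtain ⟨N, hN⟩ := key (ε / 2) (half_pos hε)
  refine ⟨N, fun n hn => ?_⟩
  rw [Real.dist_eq, sub_zero, abs_of_nonneg (energyForm_self_nonneg _)]
  linarith [(hN n hn).2]

/-- The energy form on all functions of finite energy is a resistance form. -/
theorem isResistanceForm_domE (hconn : G.Connected) (hfin : G.LocallyFinite) :
    IsResistanceForm G.energyForm G.domE where
  const_mem := const_mem_domE
  add_mem _ hu _ hv := add_mem_domE hu hv
  smul_mem a _ hu := smul_mem_domE a hu
  map_add _ hu _ hv _ hw := energyForm_add_left hu hv hw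
  map_smul a u _ v _ := energyForm_smul_left a u v
  map_symm u _ v _ := energyForm_comm u v
  map_nonneg u _ := energyForm_self_nonneg u
  map_eq_zero_iff u hu := by
    constructor
    · intro h
      obtain ⟨o⟩ := hconn.nonempty
      exact ⟨u o, fun x => eq_const_of_energyForm_eq_zero hconn hu h x o⟩
    · rintro ⟨k, hk⟩
      rw [show u = fun _ => k from funext hk, energyForm_const]
  complete := domE_complete hconn
  extend W v := by
    classical
    refine ⟨fun x => if x ∈ W then v x else 0,
      finiteFunctions_subset_domE hfin ⟨0, W, fun x hx => if_neg hx⟩, fun x hx => if_pos hx⟩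
  bounded := exists_sq_sub_le hconn
  markov u hu := ⟨clamp_mem_domE hu, energyForm_clamp_le hu⟩

end WeightedGraph

/-! ### Resistance forms: Hilbert space calculus and harmonic extension -/

namespace IsResistanceForm

variable {X : Type*} {E : (X → ℝ) → (X → ℝ) → ℝ} {F : Set (X → ℝ)}

theorem sub_mem (h : IsResistanceForm E F) {u v : X → ℝ} (hu : u ∈ F) (hv : v ∈ F) :
    u - v ∈ F := by
  have := h.add_mem u hu _ (h.smul_mem (-1) v hv)
  rwa [neg_one_smul, ← sub_eq_add_neg] at this

theorem map_sub_left (h : IsResistanceForm E F) {u v w : X → ℝ} (hu : u ∈ F) (hv : v ∈ F)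
    (hw : w ∈ F) : E (u - v) w = E u w - E v w := by
  have := h.map_add (u - v) (h.sub_mem hu hv) v hv w hw
  rw [sub_add_cancel] at this
  linarith

theorem map_add_right (h : IsResistanceForm E F) {u v w : X → ℝ} (hu : u ∈ F) (hv : v ∈ F)
    (hw : w ∈ F) : E w (u + v) = E w u + E w v := by
  rw [h.map_symm w hw _ (h.add_mem u hu v hv), h.map_add u hu v hv w hw, h.map_symm u hu w hw,
    h.map_symm v hv w hw]

theorem map_smul_right (h : IsResistanceForm E F) (a : ℝ) {u v : X → ℝ} (hu : u ∈ F)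
    (hv : v ∈ F) : E u (a • v) = a * E u v := by
  rw [h.map_symm u hu _ (h.smul_mem a v hv), h.map_smul a v hv u hu, h.map_symm v hv u hu]

theorem map_sub_right (h : IsResistanceForm E F) {u v w : X → ℝ} (hu : u ∈ F) (hv : v ∈ F)
    (hw : w ∈ F) : E w (u - v) = E w u - E w v := by
  rw [h.map_symm w hw _ (h.sub_mem hu hv), h.map_sub_left hu hv hw, h.map_symm u hu w hw,
    h.map_symm v hv w hw]

theorem energy_add (h : IsResistanceForm E F) {u v : X → ℝ} (hu : u ∈ F) (hv : v ∈ F) :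
    E (u + v) (u + v) = E u u + 2 * E u v + E v v := by
  have huv := h.add_mem u hu v hv
  rw [h.map_add u hu v hv _ huv, h.map_add_right hu hv hu, h.map_add_right hu hv hv,
    h.map_symm v hv u hu]
  ring

theorem energy_sub (h : IsResistanceForm E F) {u v : X → ℝ} (hu : u ∈ F) (hv : v ∈ F) :
    E (u - v) (u - v) = E u u - 2 * E u v + E v v := by
  have huv := h.sub_mem hu hv
  rw [h.map_sub_left hu hv huv, h.map_sub_right hu hv hu, h.map_sub_right hu hv hv,
    h.map_symm v hv u hu]
  ring

theorem energy_smul (h : IsResistanceForm E F) (a : ℝ) {u : X → ℝ} (hu : u ∈ F) :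
    E (a • u) (a • u) = a ^ 2 * E u u := by
  rw [h.map_smul a u hu _ (h.smul_mem a u hu), h.map_smul_right a hu hu]
  ring

theorem cauchy_schwarz (h : IsResistanceForm E F) {u v : X → ℝ} (hu : u ∈ F) (hv : v ∈ F) :
    E u v ^ 2 ≤ E u u * E v v := by
  have key : ∀ t : ℝ, 0 ≤ E v v * (t * t) + 2 * E u v * t + E u u := by
    intro t
    have htv := h.smul_mem t v hv
    have := h.map_nonneg _ (h.add_mem u hu _ htv)
    rw [h.energy_add hu htv, h.energy_smul t hv, h.map_smul_right t hu hv] at this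
    linarith
  have := discrim_le_zero key
  rw [discrim] at this
  linarith

theorem energy_add_le (h : IsResistanceForm E F) {u v : X → ℝ} (hu : u ∈ F) (hv : v ∈ F) :
    E (u + v) (u + v) ≤ 2 * E u u + 2 * E v v := by
  have := h.map_nonneg _ (h.sub_mem hu hv)
  rw [h.energy_sub hu hv] at this
  rw [h.energy_add hu hv]
  linarith

theorem energy_const (h : IsResistanceForm E F) (k : ℝ) : E (fun _ => k) (fun _ => k) = 0 :=
  (h.map_eq_zero_iff _ (h.const_mem k)).2 ⟨k, fun _ => rfl⟩

theorem map_const_left (h : IsResistanceForm E F) (k : ℝ) {u : X → ℝ} (hu : u ∈ F) :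
    E (fun _ => k) u = 0 := by
  have := h.cauchy_schwarz (h.const_mem k) hu
  rw [h.energy_const, zero_mul] at this
  exact pow_eq_zero_iff two_ne_zero |>.1 (le_antisymm this (sq_nonneg _))

theorem energy_add_const (h : IsResistanceForm E F) (k : ℝ) {u : X → ℝ} (hu : u ∈ F) :
    E (u + fun _ => k) (u + fun _ => k) = E u u := by
  rw [h.energy_add hu (h.const_mem k), h.map_symm _ hu _ (h.const_mem k), h.map_const_left k hu,
    h.energy_const]
  ring

theorem eq_of_energy_sub_eq_zero (h : IsResistanceForm E F) {u v : X → ℝ} (hu : u ∈ F)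
    (hv : v ∈ F) (h0 : E (u - v) (u - v) = 0) {o : X} (ho : u o = v o) : u = v := by
  obtain ⟨k, hk⟩ := (h.map_eq_zero_iff _ (h.sub_mem hu hv)).1 h0
  ext x
  have h1 := hk x
  have h2 := hk o
  simp only [Pi.sub_apply] at h1 h2
  linarith

theorem bounded_nonneg (h : IsResistanceForm E F) (p q : X) :
    ∃ C : ℝ, 0 < C ∧ ∀ u ∈ F, (u p - u q) ^ 2 ≤ C * E u u := by
  obtain ⟨C, hC⟩ := h.bounded p q
  refine ⟨|C| + 1, by positivity, fun u hu => (hC u hu).trans ?_⟩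
  exact mul_le_mul_of_nonneg_right ((le_abs_self C).trans (by linarith)) (h.map_nonneg u hu)

/-- By (RF4), differences of point evaluations are continuous for the energy. -/
theorem tendsto_sub_of_tendsto_energy (h : IsResistanceForm E F) {ι : Type*} {l : Filter ι}
    {u : ι → X → ℝ}
    {v : X → ℝ} (hu : ∀ n, u n ∈ F) (hv : v ∈ F)
    (ht : Tendsto (fun n => E (u n - v) (u n - v)) l (𝓝 0)) (p q : X) :
    Tendsto (fun n => u n p - u n q) l (𝓝 (v p - v q)) := by
  obtain ⟨C, hC0, hC⟩ := h.bounded_nonneg p q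
  rw [← tendsto_sub_nhds_zero_iff]
  have h1 : Tendsto (fun n => (u n p - u n q - (v p - v q)) ^ 2) l (𝓝 0) := by
    refine squeeze_zero (fun n => sq_nonneg _) (fun n => ?_) (by simpa using ht.const_mul C)
    have := hC _ (h.sub_mem (hu n) hv)
    simp only [Pi.sub_apply] at this
    refine le_trans (le_of_eq ?_) this
    ring
  rw [tendsto_zero_iff_abs_tendsto_zero]
  have h2 := (Real.continuous_sqrt.tendsto _).comp h1
  simpa [Function.comp_def, Real.sqrt_sq_eq_abs] using h2

theorem tendsto_map_of_tendsto_energy (h : IsResistanceForm E F) {ι : Type*} {l : Filter ι}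
    {u : ι → X → ℝ} {v w : X → ℝ} (hu : ∀ n, u n ∈ F) (hv : v ∈ F) (hw : w ∈ F)
    (ht : Tendsto (fun n => E (u n - v) (u n - v)) l (𝓝 0)) :
    Tendsto (fun n => E (u n) w) l (𝓝 (E v w)) := by
  rw [← tendsto_sub_nhds_zero_iff]
  have h1 : Tendsto (fun n => (E (u n) w - E v w) ^ 2) l (𝓝 0) := by
    refine squeeze_zero (fun n => sq_nonneg _) (fun n => ?_)
      (by simpa using ht.mul_const (E w w))
    rw [← h.map_sub_left (hu n) hv hw]
    exact h.cauchy_schwarz (h.sub_mem (hu n) hv) hw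
  rw [tendsto_zero_iff_abs_tendsto_zero]
  have h2 := (Real.continuous_sqrt.tendsto _).comp h1
  simpa [Function.comp_def, Real.sqrt_sq_eq_abs] using h2

theorem tendsto_energy (h : IsResistanceForm E F) {ι : Type*} {l : Filter ι}
    {u : ι → X → ℝ} {v : X → ℝ} (hu : ∀ n, u n ∈ F) (hv : v ∈ F)
    (ht : Tendsto (fun n => E (u n - v) (u n - v)) l (𝓝 0)) :
    Tendsto (fun n => E (u n) (u n)) l (𝓝 (E v v)) := by
  have h1 := h.tendsto_map_of_tendsto_energy hu hv hv ht
  have h2 := (ht.add (h1.const_mul 2)).sub (tendsto_const_nhds (x := E v v))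
  have e : 0 + 2 * E v v - E v v = E v v := by ring
  rw [e] at h2
  refine h2.congr fun n => ?_
  rw [h.energy_sub (hu n) hv]
  ring

/-- Existence of the harmonic extension: every function on a finite non-empty set `W` extends to
an element of the domain that is orthogonal to all elements vanishing on `W`. -/
theorem exists_harmonic_extension (h : IsResistanceForm E F) (W : Finset X) (hW : W.Nonempty)
    (f : X → ℝ) :
    ∃ u ∈ F, (∀ x ∈ W, u x = f x) ∧ ∀ g ∈ F, (∀ x ∈ W, g x = 0) → E u g = 0 := by
  obtain ⟨o, ho⟩ := hW
  set S : Set ℝ := {r | ∃ u ∈ F, (∀ x ∈ W, u x = f x) ∧ r = E u u} with hS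
  obtain ⟨u₀, hu₀, hu₀W⟩ := h.extend W f
  have hne : S.Nonempty := ⟨_, u₀, hu₀, hu₀W, rfl⟩
  have hbdd : BddBelow S := ⟨0, by rintro r ⟨u, hu, -, rfl⟩; exact h.map_nonneg u hu⟩
  set m := sInf S with hm
  have hmle : ∀ u ∈ F, (∀ x ∈ W, u x = f x) → m ≤ E u u :=
    fun u hu huW => csInf_le hbdd ⟨u, hu, huW, rfl⟩
  have hex : ∀ n : ℕ, ∃ u ∈ F, (∀ x ∈ W, u x = f x) ∧ E u u < m + 1 / ((n : ℝ) + 1) := by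
    intro n
    obtain ⟨r, ⟨u, hu, huW, rfl⟩, hr⟩ :=
      exists_lt_of_csInf_lt hne (lt_add_of_pos_right m (Nat.one_div_pos_of_nat (n := n)))
    exact ⟨u, hu, huW, hr⟩
  choose u hu huW hum using hex
  -- Parallelogram law: the midpoint of two competitors is a competitor, hence has energy at least
  -- `m`, so $\mathcal E(u_i-u_j)\le2\mathcal E(u_i)+2\mathcal E(u_j)-4m$. This is where `ε / 4`
  -- comes from.
  have hcau : ∀ ε > 0, ∃ N, ∀ m ≥ N, ∀ n ≥ N, E (u m - u n) (u m - u n) < ε := by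
    intro ε hε
    obtain ⟨N, hN⟩ := exists_nat_one_div_lt (show 0 < ε / 4 by positivity)
    refine ⟨N, fun i hi j hj => ?_⟩
    have hmid := h.smul_mem (1 / 2) _ (h.add_mem _ (hu i) _ (hu j))
    have h1 := hmle _ hmid fun x hx => by
      simp only [Pi.smul_apply, Pi.add_apply, huW i x hx, huW j x hx, smul_eq_mul]
      ring
    rw [h.energy_smul _ (h.add_mem _ (hu i) _ (hu j)), h.energy_add (hu i) (hu j)] at h1
    rw [h.energy_sub (hu i) (hu j)]
    have hi' := Nat.one_div_le_one_div (α := ℝ) hi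
    have hj' := Nat.one_div_le_one_div (α := ℝ) hj
    linarith [hum i, hum j]
  obtain ⟨v, hv, hvt⟩ := h.complete u hu hcau
  -- The energy limit is fixed only up to a constant; differences of values survive, and adding `f o
  -- - v o` restores the values on `W`.
  have hval : ∀ x ∈ W, v x - v o = f x - f o := by
    intro x hx
    have := h.tendsto_sub_of_tendsto_energy hu hv hvt x o
    simp only [huW _ x hx, huW _ o ho] at this
    exact tendsto_nhds_unique this tendsto_const_nhds
  refine ⟨v + fun _ => f o - v o, h.add_mem _ hv _ (h.const_mem _), fun x hx => ?_,
    fun g hg hgW => ?_⟩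
  · simp only [Pi.add_apply]
    linarith [hval x hx]
  rw [h.map_add v hv _ (h.const_mem _) g hg, h.map_const_left _ hg, add_zero]
  -- Every `u n + t • g` is still a competitor, so a quadratic polynomial in `t` is non-negative;
  -- its discriminant bounds the pairing by the excess of the energy of `u n` over `m`.
  have hsq : ∀ n : ℕ, E (u n) g ^ 2 ≤ E g g * (1 / ((n : ℝ) + 1)) := by
    intro n
    have key : ∀ t : ℝ, 0 ≤ E g g * (t * t) + 2 * E (u n) g * t + (E (u n) (u n) - m) := by
      intro t
      have htg := h.smul_mem t g hg
      have := hmle _ (h.add_mem _ (hu n) _ htg) fun x hx => by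
        simp [huW n x hx, hgW x hx]
      rw [h.energy_add (hu n) htg, h.energy_smul t hg, h.map_smul_right t (hu n) hg] at this
      linarith
    have h1 := discrim_le_zero key
    rw [discrim] at h1
    have h2 : E g g * (E (u n) (u n) - m) ≤ E g g * (1 / ((n : ℝ) + 1)) :=
      mul_le_mul_of_nonneg_left (by linarith [hum n]) (h.map_nonneg g hg)
    linarith
  have h1 := (h.tendsto_map_of_tendsto_energy hu hv hg hvt).pow 2
  have h2 : Tendsto (fun n : ℕ => E g g * (1 / ((n : ℝ) + 1))) atTop (𝓝 (E g g * 0)) :=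
    tendsto_one_div_add_atTop_nhds_zero_nat.const_mul _
  have h3 := le_of_tendsto_of_tendsto' h1 h2 hsq
  rw [mul_zero] at h3
  exact pow_eq_zero_iff two_ne_zero |>.1 (le_antisymm h3 (sq_nonneg _))

theorem energies_nonempty (h : IsResistanceForm E F) {x y : X} (hxy : x ≠ y) :
    {r : ℝ | ∃ u ∈ F, u x = 1 ∧ u y = 0 ∧ r = E u u}.Nonempty := by
  classical
  obtain ⟨u, hu, huW⟩ := h.extend {x, y} (Pi.single x 1)
  exact ⟨_, u, hu, by simpa using huW x (by simp),
    by simpa [Pi.single_apply, hxy.symm] using huW y (by simp), rfl⟩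

theorem energies_bddBelow (h : IsResistanceForm E F) (x y : X) :
    BddBelow {r : ℝ | ∃ u ∈ F, u x = 1 ∧ u y = 0 ∧ r = E u u} :=
  ⟨0, by rintro r ⟨u, hu, -, -, rfl⟩; exact h.map_nonneg u hu⟩

theorem sInf_energies_pos (h : IsResistanceForm E F) {x y : X} (hxy : x ≠ y) :
    0 < sInf {r : ℝ | ∃ u ∈ F, u x = 1 ∧ u y = 0 ∧ r = E u u} := by
  obtain ⟨C, hC0, hC⟩ := h.bounded_nonneg x y
  refine lt_of_lt_of_le (one_div_pos.2 hC0) (le_csInf (h.energies_nonempty hxy) ?_)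
  rintro r ⟨u, hu, hx, hy, rfl⟩
  have := hC u hu
  rw [hx, hy] at this
  rw [div_le_iff₀ hC0]
  linarith

end IsResistanceForm

theorem resistance_self {X : Type*} (E : (X → ℝ) → (X → ℝ) → ℝ) (F : Set (X → ℝ)) (x : X) :
    resistance E F x x = 0 := by
  have : {r : ℝ | ∃ u ∈ F, u x = 1 ∧ u x = 0 ∧ r = E u u} = ∅ := by
    ext r
    simp only [Set.mem_ofPred_eq, Set.mem_empty_iff_false, iff_false]
    rintro ⟨u, -, h1, h0, -⟩
    exact one_ne_zero (h1.symm.trans h0)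
  rw [resistance, this, Real.sInf_empty, inv_zero]

namespace IsResistanceForm

variable {X : Type*} {E : (X → ℝ) → (X → ℝ) → ℝ} {F : Set (X → ℝ)}

theorem sum_smul_mem (h : IsResistanceForm E F) {ι : Type*} (s : Finset ι) (a : ι → ℝ)
    {g : ι → X → ℝ} (hg : ∀ i, g i ∈ F) : ∑ i ∈ s, a i • g i ∈ F :=
  Finset.sum_induction _ (· ∈ F) (fun u v hu hv => h.add_mem u hu v hv) (h.const_mem 0)
    fun i _ => h.smul_mem _ _ (hg i)

theorem map_sum_smul_right (h : IsResistanceForm E F) {ι : Type*} (s : Finset ι) (a : ι → ℝ)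
    {g : ι → X → ℝ} (hg : ∀ i, g i ∈ F) {u : X → ℝ} (hu : u ∈ F) :
    E u (∑ i ∈ s, a i • g i) = ∑ i ∈ s, a i * E u (g i) := by
  classical
  induction s using Finset.induction_on with
  | empty =>
    have := h.map_const_left 0 hu
    rw [h.map_symm _ (h.const_mem 0) u hu] at this
    rw [Finset.sum_empty, Finset.sum_empty]
    exact this
  | insert i s hi ih =>
    rw [Finset.sum_insert hi, Finset.sum_insert hi,
      h.map_add_right (h.smul_mem _ _ (hg i)) (h.sum_smul_mem s a hg) hu,
      h.map_smul_right _ hu (hg i), ih]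

theorem map_sum_smul_left (h : IsResistanceForm E F) {ι : Type*} (s : Finset ι) (a : ι → ℝ)
    {g : ι → X → ℝ} (hg : ∀ i, g i ∈ F) {u : X → ℝ} (hu : u ∈ F) :
    E (∑ i ∈ s, a i • g i) u = ∑ i ∈ s, a i * E (g i) u := by
  rw [h.map_symm _ (h.sum_smul_mem s a hg) u hu, h.map_sum_smul_right s a hg hu]
  exact Finset.sum_congr rfl fun i _ => by rw [h.map_symm u hu _ (hg i)]

end IsResistanceForm

/-! ### Finite graphs: potentials, effective resistance, uniqueness -/

namespace WeightedGraph

variable {V : Type*}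

section Finite

variable [Fintype V] {K : WeightedGraph V}

theorem locallyFinite_of_finite (K : WeightedGraph V) : K.LocallyFinite :=
  fun _ => Summable.of_finite

theorem domE_eq_univ (K : WeightedGraph V) : K.domE = Set.univ :=
  Set.eq_univ_of_forall fun _ => Summable.of_finite

theorem isResistanceForm_univ (hK : K.Connected) :
    IsResistanceForm K.energyForm Set.univ := by
  have := isResistanceForm_domE hK K.locallyFinite_of_finite
  rwa [domE_eq_univ] at this

theorem pi_eq_sum_single [DecidableEq V] (v : V → ℝ) :
    v = ∑ y, v y • (Pi.single y 1 : V → ℝ) := by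
  ext x
  simp [Finset.sum_apply, Pi.single_apply]

/-- The unnormalized Laplacian of a finite weighted graph. -/
def combLaplacian (K : WeightedGraph V) (f : V → ℝ) (z : V) : ℝ := ∑ w, K.c z w * (f z - f w)

/-- Discrete Green formula: after splitting `v x - v y`, exchanging the summation indices shows that
both halves contribute equally, which absorbs the factor 1/2. -/
theorem energyForm_eq_sum_combLaplacian (u v : V → ℝ) :
    K.energyForm u v = ∑ z, v z * K.combLaplacian u z := by
  have h1 : ∑ x, ∑ y, K.c x y * (u x - u y) * v x = ∑ z, v z * K.combLaplacian u z := by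
    refine Finset.sum_congr rfl fun x _ => ?_
    rw [combLaplacian, Finset.mul_sum]
    exact Finset.sum_congr rfl fun y _ => by ring
  have h2 : ∑ x, ∑ y, K.c x y * (u x - u y) * v y = -∑ z, v z * K.combLaplacian u z := by
    rw [Finset.sum_comm, ← h1, ← Finset.sum_neg_distrib]
    refine Finset.sum_congr rfl fun x _ => ?_
    rw [← Finset.sum_neg_distrib]
    exact Finset.sum_congr rfl fun y _ => by rw [K.symm y x]; ring
  rw [energyForm, tsum_fintype, Fintype.sum_prod_type]
  simp only [mul_sub _ (v _), Finset.sum_sub_distrib]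
  rw [h1, h2]
  ring

theorem sum_combLaplacian (K : WeightedGraph V) (f : V → ℝ) : ∑ z, K.combLaplacian f z = 0 := by
  have h := energyForm_eq_sum_combLaplacian (K := K) f (fun _ => 1)
  simpa [energyForm] using h.symm

theorem eq_of_combLaplacian_eq_zero (hK : K.Connected) {f : V → ℝ}
    (h : ∀ z, K.combLaplacian f z = 0) (x y : V) : f x = f y := by
  refine eq_const_of_energyForm_eq_zero hK (by rw [domE_eq_univ]; trivial) ?_ x y
  rw [energyForm_eq_sum_combLaplacian]
  simp [h]

theorem combLaplacian_add (f g : V → ℝ) (z : V) :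
    K.combLaplacian (f + g) z = K.combLaplacian f z + K.combLaplacian g z := by
  simp only [combLaplacian, ← Finset.sum_add_distrib, Pi.add_apply]
  exact Finset.sum_congr rfl fun _ _ => by ring

theorem combLaplacian_smul (a : ℝ) (f : V → ℝ) (z : V) :
    K.combLaplacian (a • f) z = a * K.combLaplacian f z := by
  simp only [combLaplacian, Finset.mul_sum, Pi.smul_apply, smul_eq_mul]
  exact Finset.sum_congr rfl fun _ _ => by ring

/-- The unnormalized Laplacian as a linear map. -/
def combLaplacianHom (K : WeightedGraph V) : (V → ℝ) →ₗ[ℝ] (V → ℝ) where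
  toFun := K.combLaplacian
  map_add' f g := funext fun z => combLaplacian_add f g z
  map_smul' a f := funext fun z => combLaplacian_smul a f z

/-- The Dirichlet problem in a finite connected graph has a solution. -/
theorem exists_potential [DecidableEq V] (hK : K.Connected) (x y : V) :
    ∃ φ : V → ℝ, K.combLaplacian φ = Pi.single x 1 - Pi.single y 1 ∧ φ y = 0 := by
  -- The rank-one term $f(y)\mathbf 1_y$ makes the Laplacian injective. Laplacians sum to zero, so
  -- summing `T f` recovers `f y`; for right-hand sides of sum zero the extra term therefore
  -- vanishes.
  let T : (V → ℝ) →ₗ[ℝ] (V → ℝ) :=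
    K.combLaplacianHom + (LinearMap.proj (R := ℝ) (φ := fun _ : V => ℝ) y).smulRight
      (Pi.single y 1 : V → ℝ)
  have hT : ∀ f, T f = K.combLaplacian f + f y • (Pi.single y 1 : V → ℝ) := fun f => rfl
  have hsum : ∀ f, ∑ z, T f z = f y := by
    intro f
    simp [hT, Finset.sum_add_distrib, sum_combLaplacian K, Pi.single_apply]
  have hinj : Function.Injective T := by
    rw [← LinearMap.ker_eq_bot, LinearMap.ker_eq_bot']
    intro f hf
    have h0 : f y = 0 := by rw [← hsum f, hf]; simp
    ext z
    rw [eq_of_combLaplacian_eq_zero hK (f := f) (fun z => ?_) z y, h0, Pi.zero_apply]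
    have := congrFun hf z
    simpa [hT, h0] using this
  obtain ⟨φ, hφ⟩ := LinearMap.injective_iff_surjective.1 hinj
    (Pi.single x 1 - Pi.single y 1 : V → ℝ)
  have h0 : φ y = 0 := by rw [← hsum φ, hφ]; simp
  refine ⟨φ, ?_, h0⟩
  rw [← hφ, hT, h0, zero_smul, add_zero]

theorem totalWeight_pos (hK : K.Connected) [Nontrivial V] (z : V) : 0 < K.totalWeight z := by
  obtain ⟨w, hw⟩ := hK.preconnected.exists_adj_of_nontrivial z
  have hw : 0 < K.c z w := hw
  rw [totalWeight, tsum_fintype]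
  exact Finset.sum_pos' (fun _ _ => K.nonneg _ _) ⟨w, Finset.mem_univ _, hw⟩

theorem isDirichletSolution_iff [DecidableEq V] (hK : K.Connected) (x y : V) (φ : V → ℝ) :
    K.IsDirichletSolution x y φ ↔
      K.combLaplacian φ = Pi.single x 1 - Pi.single y 1 ∧ φ y = 0 := by
  refine and_congr_left fun hy => ?_
  rw [funext_iff]
  refine forall_congr' fun z => ?_
  -- On a single vertex the total weight is 0 and cannot be cancelled, but there both equations
  -- reduce to `0 = 0`.
  rcases subsingleton_or_nontrivial V with hV | hV
  · have h1 : x = z := Subsingleton.elim _ _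
    have h2 : y = z := Subsingleton.elim _ _
    subst h1 h2
    have h3 : ∀ w, K.c y w = 0 := fun w => by rw [Subsingleton.elim w y, K.diag]
    simp [laplacian, combLaplacian, h3, hy]
  · have hz := totalWeight_pos hK z
    have h1 : K.combLaplacian φ z = K.totalWeight z * K.laplacian φ z := by
      simp only [laplacian, combLaplacian, mul_sub, Finset.sum_sub_distrib, tsum_fintype,
        ← Finset.sum_mul, Finset.mul_sum]
      congr 1
      · rw [totalWeight, tsum_fintype]
      · refine Finset.sum_congr rfl fun w _ => ?_
        field_simp
    rw [h1, ← mul_right_inj' hz.ne', Pi.sub_apply, Pi.single_apply, Pi.single_apply]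
    refine Eq.congr rfl ?_
    by_cases hx : z = x <;> by_cases hy : z = y <;> subst_vars <;> simp_all [hz.ne']

/-- The effective resistance is given by any potential. -/
theorem effectiveResistance_eq_of_potential [DecidableEq V] (hK : K.Connected) {x y : V}
    {φ : V → ℝ} (hφ : K.combLaplacian φ = Pi.single x 1 - Pi.single y 1) :
    K.effectiveResistance x y = φ x - φ y := by
  obtain ⟨ψ, hψ⟩ := exists_potential hK x y
  have hex : ∃ φ, K.IsDirichletSolution x y φ := ⟨ψ, (isDirichletSolution_iff hK x y ψ).2 hψ⟩
  rw [effectiveResistance, dif_pos hex]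
  have h := (isDirichletSolution_iff hK x y _).1 hex.choose_spec
  have h1 := eq_of_combLaplacian_eq_zero hK (f := hex.choose + (-1 : ℝ) • φ) (fun z => by
    rw [combLaplacian_add, combLaplacian_smul, h.1, hφ]
    ring) x y
  simp only [Pi.add_apply, Pi.smul_apply, smul_eq_mul, h.2] at h1
  linarith

/-- The potential is the Riesz representative of $v\mapsto v(x)-v(y)$. -/
theorem energyForm_potential [DecidableEq V] {x y : V}
    {φ : V → ℝ} (hφ : K.combLaplacian φ = Pi.single x 1 - Pi.single y 1) (v : V → ℝ) :
    K.energyForm φ v = v x - v y := by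
  rw [energyForm_eq_sum_combLaplacian, hφ]
  simp [mul_sub, Pi.single_apply]

/-- In a finite connected graph the effective resistance is the inverse of the minimal energy. -/
theorem effectiveResistance_eq_resistance (hK : K.Connected) (x y : V) :
    K.effectiveResistance x y = resistance K.energyForm Set.univ x y := by
  classical
  obtain ⟨φ, hφ, hφy⟩ := exists_potential hK x y
  rw [effectiveResistance_eq_of_potential hK hφ]
  rcases eq_or_ne x y with rfl | hxy
  · rw [resistance_self, sub_self]
  have hF := isResistanceForm_univ hK
  have hE := energyForm_potential hφ
  rw [hφy, sub_zero]
  -- Here $\phi(x)=\mathcal E(\phi,\phi)$; if it were 0, Cauchy–Schwarz against $\mathbf 1_x$ would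
  -- give $1\le0$.
  have hpos : 0 < φ x := by
    have h1 := hF.cauchy_schwarz (Set.mem_univ φ) (Set.mem_univ (Pi.single x 1))
    rw [hE, hE, hφy] at h1
    have h2 := hF.map_nonneg φ trivial
    rw [hE, hφy, sub_zero] at h2
    refine h2.lt_of_ne fun h => ?_
    simp [← h, hxy.symm] at h1
    linarith
  -- Cauchy–Schwarz against $\phi$ gives $1\le\phi(x)\mathcal E(u,u)$, with equality for
  -- $u=\phi/\phi(x)$.
  have hleast : IsLeast {r : ℝ | ∃ u ∈ (Set.univ : Set (V → ℝ)), u x = 1 ∧ u y = 0 ∧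
      r = K.energyForm u u} (φ x)⁻¹ := by
    constructor
    · refine ⟨(φ x)⁻¹ • φ, trivial, ?_, ?_, ?_⟩
      · simp [hpos.ne']
      · simp [hφy]
      · rw [hF.energy_smul _ trivial, hE, hφy]
        field_simp
        ring
    · rintro r ⟨u, -, hx, hy, rfl⟩
      have h1 := hF.cauchy_schwarz (Set.mem_univ φ) (Set.mem_univ u)
      rw [hE, hE, hφy, hx, hy] at h1
      rw [inv_le_iff_one_le_mul₀ hpos]
      linarith
  rw [resistance, hleast.csInf_eq, inv_inv]

/-- The potentials are determined by the effective resistance. -/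
theorem potential_apply [DecidableEq V] (hK : K.Connected) {y : V} {φ : V → V → ℝ}
    (hφ : ∀ x, K.combLaplacian (φ x) = Pi.single x 1 - Pi.single y 1 ∧ φ x y = 0) (x z : V) :
    φ x z = (K.effectiveResistance x y + K.effectiveResistance z y -
      K.effectiveResistance x z) / 2 := by
  have hsymm : φ x z = φ z x := by
    have h1 := energyForm_potential (hφ x).1 (φ z)
    have h2 := energyForm_potential (hφ z).1 (φ x)
    rw [energyForm_comm, h1, (hφ x).2, (hφ z).2] at h2
    linarith
  -- The poles at `y` cancel, so `φ x - φ z` is a potential for the pair `x`, `z`; this gives the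
  -- polarization identity.
  have h3 : K.combLaplacian (φ x + (-1 : ℝ) • φ z) = Pi.single x 1 - Pi.single z 1 := by
    ext w
    rw [combLaplacian_add, combLaplacian_smul, (hφ x).1, (hφ z).1]
    simp only [Pi.sub_apply]
    ring
  rw [effectiveResistance_eq_of_potential hK (hφ x).1,
    effectiveResistance_eq_of_potential hK (hφ z).1, effectiveResistance_eq_of_potential hK h3,
    (hφ x).2, (hφ z).2]
  simp only [Pi.add_apply, Pi.smul_apply, smul_eq_mul]
  linarith

/-- A finite connected graph is determined by its effective resistance. -/
theorem eq_of_effectiveResistance_eq {K' : WeightedGraph V} (hK : K.Connected)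
    (hK' : K'.Connected) (h : ∀ x y, K.effectiveResistance x y = K'.effectiveResistance x y) :
    K = K' := by
  classical
  obtain ⟨y⟩ := hK.nonempty
  choose φ hφ using fun x => exists_potential hK x y
  choose ψ hψ using fun x => exists_potential hK' x y
  have hφψ : φ = ψ := by
    ext x z
    rw [potential_apply hK hφ, potential_apply hK' hψ, h, h, h]
  subst hφψ
  -- Potentials weighted by the charges of `f` reproduce these charges: the total charge is zero, so
  -- the poles at `y` cancel. As `K` and `K'` share the potentials, both Laplacians are inverted by
  -- the same operator.
  have hs : ∀ (M : WeightedGraph V)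
      (_ : ∀ x, M.combLaplacian (φ x) = Pi.single x 1 - Pi.single y 1) (f : V → ℝ),
      M.combLaplacian (∑ x, K.combLaplacian f x • φ x) = K.combLaplacian f := by
    intro M hMφ f
    change M.combLaplacianHom _ = _
    rw [map_sum]
    simp only [map_smul]
    have : ∀ x, M.combLaplacianHom (φ x) = Pi.single x 1 - Pi.single y 1 := hMφ
    simp only [this, smul_sub, Finset.sum_sub_distrib, ← Finset.sum_smul,
      sum_combLaplacian K f, zero_smul, sub_zero]
    exact (pi_eq_sum_single _).symm
  have hL : ∀ f, K'.combLaplacian f = K.combLaplacian f := by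
    intro f
    have h1 := hs K (fun x => (hφ x).1) f
    have h2 := hs K' (fun x => (hψ x).1) f
    set g := ∑ x, K.combLaplacian f x • φ x
    have h3 : f = g + fun _ => f y - g y := by
      ext x
      have := eq_of_combLaplacian_eq_zero hK (f := f + (-1 : ℝ) • g) (fun z => by
        rw [combLaplacian_add, combLaplacian_smul, h1]; ring) x y
      simp only [Pi.add_apply, Pi.smul_apply, smul_eq_mul] at this ⊢
      linarith
    rw [← h2]
    ext z
    conv_lhs => rw [h3]
    simp [combLaplacian]
  ext x z
  rcases eq_or_ne x z with rfl | hxz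
  · rw [K.diag, K'.diag]
  have hc : ∀ M : WeightedGraph V, M.combLaplacian (Pi.single z 1) x = -M.c x z := by
    intro M
    simp [combLaplacian, Pi.single_apply, hxz]
  have := congrFun (hL (Pi.single z 1)) x
  rw [hc, hc] at this
  linarith

/-- The indicator of a connected component has energy zero, hence is constant. -/
theorem connected_of_energyForm_eq_zero [Nonempty V]
    (h : ∀ v, K.energyForm v v = 0 → ∀ x y, v x = v y) : K.Connected := by
  classical
  refine ⟨fun x y => ?_⟩
  have := h (fun z => if K.toSimpleGraph.Reachable x z then 1 else 0) ?_ x y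
  · by_contra hxy
    simp [hxy] at this
  · rw [energyForm_self]
    have : ∀ p : V × V, K.c p.1 p.2 *
        ((if K.toSimpleGraph.Reachable x p.1 then (1 : ℝ) else 0) -
          (if K.toSimpleGraph.Reachable x p.2 then (1 : ℝ) else 0)) ^ 2 = 0 := by
      rintro ⟨a, b⟩
      rcases (K.nonneg a b).eq_or_lt with h0 | h0
      · simp [← h0]
      · have hab : K.toSimpleGraph.Adj a b := h0
        have : K.toSimpleGraph.Reachable x a ↔ K.toSimpleGraph.Reachable x b :=
          ⟨fun h => h.trans hab.reachable, fun h => h.trans hab.reachable.symm⟩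
        simp [this]
    simp only [this, tsum_zero, mul_zero]

end Finite

end WeightedGraph

/-! ### Traces on finite sets and the limit graph -/

namespace WeightedGraph

variable {V : Type*} {G : WeightedGraph V}

theorem energyForm_single_of_eq_zero [DecidableEq V] (hfin : G.LocallyFinite) {u : V → ℝ} {y : V}
    (hu : ∀ z, u z ∈ Set.Icc (0 : ℝ) 1) (hy : u y = 0) :
    G.energyForm u (Pi.single y 1) = -∑' z, G.c y z * u z := by
  have hs : Summable fun z => G.c y z * u z :=
    Summable.of_nonneg_of_le (fun z => mul_nonneg (G.nonneg _ _) (hu z).1)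
      (fun z => mul_le_of_le_one_right (G.nonneg _ _) (hu z).2) (hfin y)
  refine energyForm_single ?_
  simpa [hy] using hs.hasSum.neg

/-- The trace of a resistance form on a finite non-empty set `W` is given by a connected graph,
whose weights are expressed through the energy-minimizing extensions of the point masses. -/
theorem exists_trace (hfin : G.LocallyFinite) {D : Set (V → ℝ)} (hFD : finiteFunctions V ⊆ D)
    (h : IsResistanceForm G.energyForm D) (W : Finset V)
    (hW : W.Nonempty) :
    ∃ K : WeightedGraph W, RepresentsOn (resistance G.energyForm D) W K ∧
      ∀ x y : W, x ≠ y → ∃ u : V → ℝ, (∀ z, u z ∈ Set.Icc (0 : ℝ) 1) ∧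
        (u x = 1 ∧ ∀ z ∈ W, z ≠ x → u z = 0) ∧ K.c x y = ∑' z, G.c y z * u z := by
  classical
  obtain ⟨o, ho⟩ := hW
  have hsD : ∀ y : V, (Pi.single y 1 : V → ℝ) ∈ D := fun y =>
    hFD ⟨0, {y}, fun x hx => by simp only [Finset.mem_singleton] at hx; simp [hx]⟩
  choose η hηD hηW hηorth using fun x : W =>
    h.exists_harmonic_extension W ⟨o, ho⟩ (Pi.single (x : V) 1)
  -- Truncation keeps the values on `W` and does not raise the energy, so by uniqueness of the
  -- minimizer `η x` is its own truncation.
  have hη01 : ∀ x z, η x z ∈ Set.Icc (0 : ℝ) 1 := by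
    intro x
    have hc : clamp (η x) ∈ D := (h.markov (η x) (hηD x)).1
    have hcle : G.energyForm (clamp (η x)) (clamp (η x)) ≤ G.energyForm (η x) (η x) :=
      (h.markov (η x) (hηD x)).2
    have hcW : ∀ z ∈ W, clamp (η x) z = η x z := fun z hz => clamp_of_mem_Icc <| by
      rw [hηW x z hz, Pi.single_apply]
      split_ifs <;> simp
    have hg := h.sub_mem hc (hηD x)
    have h0 := hηorth x _ hg fun z hz => sub_eq_zero.2 (hcW z hz)
    have h1 := h.energy_add (hηD x) hg
    rw [h0, add_sub_cancel] at h1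
    have h2 := h.map_nonneg _ hg
    have h3 : clamp (η x) = η x :=
      h.eq_of_energy_sub_eq_zero hc (hηD x) (le_antisymm (by linarith) h2) (hcW o ho)
    intro z
    rw [← h3]
    exact clamp_mem_Icc _ _
  have hηne : ∀ x y : W, x ≠ y → η x y = 0 := fun x y hxy => by
    rw [hηW x y y.2, Pi.single_apply, if_neg fun e => hxy (Subtype.ext e.symm)]
  -- `η x` is orthogonal to `η y - Pi.single y 1`, which vanishes on `W`, so `η y` may be replaced
  -- by the point mass.
  have hpair : ∀ x y : W, x ≠ y →
      G.energyForm (η x) (η y) = -∑' z, G.c y z * η x z := by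
    intro x y hxy
    have h0 := hηorth x _ (h.sub_mem (hηD y) (hsD y)) fun z hz =>
      sub_eq_zero.2 (hηW y z hz)
    rw [h.map_sub_right (hηD y) (hsD y) (hηD x),
      energyForm_single_of_eq_zero hfin (hη01 x) (hηne x y hxy)] at h0
    linarith
  let K : WeightedGraph W :=
    { c := fun x y => if x = y then 0 else -G.energyForm (η x) (η y)
      nonneg := fun x y => by
        split_ifs with hxy
        · exact le_rfl
        · rw [hpair x y hxy, neg_neg]
          exact tsum_nonneg fun z => mul_nonneg (G.nonneg _ _) (hη01 x z).1
      symm := fun x y => by rw [energyForm_comm]; simp only [eq_comm]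
      diag := fun x => if_pos rfl }
  have hKc : ∀ x y : W, x ≠ y → K.c x y = -G.energyForm (η x) (η y) := fun x y hxy => if_neg hxy
  let H : (W → ℝ) → V → ℝ := fun v => ∑ x, v x • η x
  have hHD : ∀ v, H v ∈ D := fun v => h.sum_smul_mem _ _ hηD
  have hHW : ∀ v, ∀ z : W, H v z = v z := by
    intro v z
    simp only [H, Finset.sum_apply, Pi.smul_apply, smul_eq_mul]
    rw [Finset.sum_eq_single z]
    · rw [hηW z z z.2, Pi.single_eq_same, mul_one]
    · intro x _ hxz
      rw [hηne x z hxz, mul_zero]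
    · simp
  have hHorth : ∀ v, ∀ g ∈ D, (∀ z ∈ W, g z = 0) → G.energyForm (H v) g = 0 := by
    intro v g hg hgW
    rw [h.map_sum_smul_left _ _ hηD hg]
    exact Finset.sum_eq_zero fun x _ => by rw [hηorth x g hg hgW, mul_zero]
  -- The harmonic extension of 1 is 1, so the rows of the matrix $\mathcal E(\eta_x,\eta_y)$ sum to
  -- zero. This makes it the Laplacian matrix of `K`.
  have hH1 : H (fun _ => 1) = fun _ => 1 := by
    have hg := h.sub_mem (hHD fun _ => 1) (h.const_mem 1)
    refine h.eq_of_energy_sub_eq_zero (hHD _) (h.const_mem 1) ?_ (hHW _ ⟨o, ho⟩)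
    rw [h.map_sub_left (hHD _) (h.const_mem 1) hg, h.map_const_left 1 hg, sub_zero]
    exact hHorth _ _ hg fun z hz => sub_eq_zero.2 (hHW _ ⟨z, hz⟩)
  have hHη : ∀ v y, G.energyForm (H v) (η y) = K.combLaplacian v y := by
    intro v y
    have h1 : ∑ x, G.energyForm (η x) (η y) = 0 := by
      have := h.map_const_left 1 (hηD y)
      rw [← hH1, h.map_sum_smul_left _ _ hηD (hηD y)] at this
      simpa using this
    rw [h.map_sum_smul_left _ _ hηD (hηD y), combLaplacian,
      ← sub_zero (∑ x, v x * _), ← mul_zero (v y), ← h1, Finset.mul_sum,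
      ← Finset.sum_sub_distrib]
    refine Finset.sum_congr rfl fun x _ => ?_
    rcases eq_or_ne y x with rfl | hxy
    · ring
    · rw [hKc y x hxy, energyForm_comm]
      ring
  have hKE : ∀ v, K.energyForm v v = G.energyForm (H v) (H v) := by
    intro v
    rw [energyForm_eq_sum_combLaplacian]
    conv_rhs => rw [show H v = ∑ x, v x • η x from rfl]
    change _ = G.energyForm (H v) _
    rw [h.map_sum_smul_right _ _ hηD (hHD v)]
    simp only [hHη]
  have : Nonempty W := ⟨⟨o, ho⟩⟩
  have hKconn : K.Connected := by
    refine connected_of_energyForm_eq_zero fun v hv x y => ?_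
    rw [hKE] at hv
    obtain ⟨k, hk⟩ := (h.map_eq_zero_iff _ (hHD v)).1 hv
    rw [← hHW v x, ← hHW v y, hk, hk]
  refine ⟨K, ⟨hKconn, fun x y => ?_⟩, fun x y hxy => ⟨η x, hη01 x, ⟨?_, ?_⟩, ?_⟩⟩
  · rw [effectiveResistance_eq_resistance hKconn, resistance, resistance]
    congr 1
    -- Each competitor on `W` extends by `H` with equal energy; each one on `V` is improved by the
    -- harmonic extension of its restriction, by Pythagoras.
    refine csInf_eq_csInf_of_forall_exists_le ?_ ?_
    · rintro r ⟨v, -, hx, hy, rfl⟩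
      exact ⟨_, ⟨H v, hHD v, by rw [hHW, hx], by rw [hHW, hy], rfl⟩, (hKE v).ge⟩
    · rintro r ⟨u, hu, hx, hy, rfl⟩
      refine ⟨_, ⟨fun z => u z, trivial, hx, hy, rfl⟩, ?_⟩
      rw [hKE]
      have hg := h.sub_mem hu (hHD fun z => u z)
      have h1 := h.energy_add (hHD fun z => u z) hg
      rw [hHorth _ _ hg fun z hz => sub_eq_zero.2 (hHW (fun z => u z) ⟨z, hz⟩).symm, add_sub_cancel] at h1
      linarith [h.map_nonneg _ hg]
  · rw [hηW x x x.2, Pi.single_eq_same]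
  · intro z hz hzx
    rw [hηW x z hz, Pi.single_apply, if_neg hzx]
  · rw [hKc x y hxy, hpair x y hxy, neg_neg]

/-- A graph is the limit graph of the resistance of each of its resistance forms. -/
theorem isLimitGraph_resistance (hfin : G.LocallyFinite) {D : Set (V → ℝ)}
    (hFD : finiteFunctions V ⊆ D) (h : IsResistanceForm G.energyForm D) :
    IsLimitGraph (resistance G.energyForm D) G := by
  classical
  intro W hW hne
  choose K hK hKc using fun n => exists_trace hfin hFD h (W n) (hne n)
  refine ⟨K, fun n => ⟨hK n, fun K₀ hK₀ => eq_of_effectiveResistance_eq hK₀.1 (hK n).1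
    fun x y => by rw [hK₀.2, (hK n).2]⟩, fun x y => ?_⟩
  have hev : ∀ z, ∀ᶠ n in atTop, z ∈ W n := by
    intro z
    obtain ⟨N, hN⟩ := hW.2 z
    filter_upwards [eventually_ge_atTop N] with n hn using hW.1 hn hN
  rcases eq_or_ne x y with rfl | hxy
  · simp only [diag, dite_eq_ite, ite_self]
    exact tendsto_const_nhds
  have hu : ∀ n, ∃ u : V → ℝ, (∀ z, u z ∈ Set.Icc (0 : ℝ) 1) ∧ ∀ hx : x ∈ W n, ∀ hy : y ∈ W n,
      (u x = 1 ∧ ∀ z ∈ W n, z ≠ x → u z = 0) ∧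
      (K n).c ⟨x, hx⟩ ⟨y, hy⟩ = ∑' z, G.c y z * u z := by
    intro n
    by_cases hxy' : x ∈ W n ∧ y ∈ W n
    · obtain ⟨u, h1, h2⟩ := hKc n ⟨x, hxy'.1⟩ ⟨y, hxy'.2⟩ (by simpa using hxy)
      exact ⟨u, h1, fun _ _ => h2⟩
    · exact ⟨fun _ => 0, by simp, fun hx hy => absurd ⟨hx, hy⟩ hxy'⟩
  choose u hu01 hu using hu
  -- Each `z` eventually lies in `W n`, where `u n` is the point mass at `x`; the majorant is `G.c
  -- y`.
  have ht : Tendsto (fun n => ∑' z, G.c y z * u n z) atTop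
      (𝓝 (∑' z, G.c y z * (Pi.single x 1 : V → ℝ) z)) := by
    refine tendsto_tsum_of_dominated_convergence (hfin y) (fun z => ?_)
      (Eventually.of_forall fun n z => ?_)
    · refine tendsto_const_nhds.congr' ?_
      filter_upwards [hev x, hev y, hev z] with n hx hy hz
      rcases eq_or_ne z x with rfl | hzx
      · rw [(hu n hx hy).1.1, Pi.single_eq_same]
      · rw [(hu n hx hy).1.2 z hz hzx, Pi.single_apply, if_neg hzx]
    · rw [norm_mul, Real.norm_of_nonneg (G.nonneg _ _), Real.norm_of_nonneg (hu01 n z).1]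
      exact mul_le_of_le_one_right (G.nonneg _ _) (hu01 n z).2
  rw [tsum_eq_single x (by intro z hz; simp [hz]), Pi.single_eq_same, mul_one, G.symm] at ht
  refine ht.congr' ?_
  filter_upwards [hev x, hev y] with n hx hy
  rw [dif_pos ⟨hx, hy⟩, (hu n hx hy).2]

end WeightedGraph

/-! ### Exhaustions and the free effective resistance -/

theorem IsFiniteExhaustion.eventually_mem {V : Type*} {W : ℕ → Finset V}
    (hW : IsFiniteExhaustion W) (x : V) : ∀ᶠ n in atTop, x ∈ W n := by
  obtain ⟨N, hN⟩ := hW.2 x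
  filter_upwards [eventually_ge_atTop N] with n hn using hW.1 hn hN

namespace WeightedGraph

variable {V : Type*} {G : WeightedGraph V}

theorem effectiveResistance_self [Finite V] (hconn : G.Connected) (x : V) :
    G.effectiveResistance x x = 0 := by
  have := Fintype.ofFinite V
  rw [effectiveResistance_eq_resistance hconn, resistance_self]

/-- The energy of the restriction of a function to a finite set of vertices. -/
noncomputable def localEnergy (G : WeightedGraph V) (W : Finset V) (u : V → ℝ) : ℝ :=
  1 / 2 * ∑ p ∈ W ×ˢ W, G.c p.1 p.2 * (u p.1 - u p.2) ^ 2

theorem energyForm_induce (W : Finset V) (u : V → ℝ) :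
    (G.induce W).energyForm (fun z => u z) (fun z => u z) = G.localEnergy W u := by
  rw [energyForm_self, localEnergy, tsum_fintype, Fintype.sum_prod_type, Finset.sum_product,
    ← Finset.sum_coe_sort W]
  congr 1
  refine Finset.sum_congr rfl fun x _ => ?_
  rw [← Finset.sum_coe_sort W]
  rfl

theorem localEnergy_nonneg (W : Finset V) (u : V → ℝ) : 0 ≤ G.localEnergy W u :=
  mul_nonneg (by norm_num) (Finset.sum_nonneg fun p _ => energy_term_nonneg u p)

theorem localEnergy_clamp_le (W : Finset V) (u : V → ℝ) :
    G.localEnergy W (clamp u) ≤ G.localEnergy W u :=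
  mul_le_mul_of_nonneg_left (Finset.sum_le_sum fun p _ => clamp_term_le u p) (by norm_num)

theorem localEnergy_le_energyForm (W : Finset V) {u : V → ℝ} (hu : u ∈ G.domE) :
    G.localEnergy W u ≤ G.energyForm u u := by
  have := sum_le_two_mul_energyForm hu (W ×ˢ W)
  rw [localEnergy]
  linarith

/-- Letting the competitors live on all of `V` makes different sets of an exhaustion comparable. -/
theorem effectiveResistance_induce (W : Finset V) (hW : (G.induce W).Connected) {x y : V}
    (hx : x ∈ W) (hy : y ∈ W) :
    (G.induce W).effectiveResistance ⟨x, hx⟩ ⟨y, hy⟩ =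
      (sInf {r | ∃ u : V → ℝ, u x = 1 ∧ u y = 0 ∧ r = G.localEnergy W u})⁻¹ := by
  classical
  rw [effectiveResistance_eq_resistance hW, resistance]
  congr 2
  ext r
  constructor
  · rintro ⟨v, -, hvx, hvy, rfl⟩
    have hv : v = fun z : W => (fun z : V => if h : z ∈ W then v ⟨z, h⟩ else 0) z := by
      ext z
      simp
    refine ⟨fun z => if h : z ∈ W then v ⟨z, h⟩ else 0, ?_, ?_, ?_⟩
    · simpa [hx] using hvx
    · simpa [hy] using hvy
    · rw [← energyForm_induce, ← hv]
  · rintro ⟨u, hux, huy, rfl⟩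
    exact ⟨fun z => u z, trivial, hux, huy, (energyForm_induce W u).symm⟩

/-- Functions with values in `[0, 1]` have a pointwise limit along every ultrafilter, and the
limit of functions of bounded energy on an exhaustion has bounded energy. -/
theorem exists_limit_of_localEnergy_le {W : ℕ → Finset V} (hW : IsFiniteExhaustion W)
    (U : Ultrafilter ℕ) (hU : ↑U ≤ (atTop : Filter ℕ)) {u : ℕ → V → ℝ} {b : ℝ}
    (hu : ∀ n z, u n z ∈ Set.Icc (0 : ℝ) 1) (hb : ∀ᶠ n in U, G.localEnergy (W n) (u n) ≤ b) :
    ∃ v : V → ℝ, (∀ z, Tendsto (fun n => u n z) U (𝓝 (v z))) ∧ v ∈ G.domE ∧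
      G.energyForm v v ≤ b := by
  have hlim : ∀ z, ∃ a, Tendsto (fun n => u n z) U (𝓝 a) := by
    intro z
    obtain ⟨a, -, ha⟩ := (isCompact_Icc (a := (0 : ℝ)) (b := 1)).ultrafilter_le_nhds
      (U.map fun n => u n z) (by
        rw [le_principal_iff]
        exact Filter.mem_map.2 (Eventually.of_forall fun n => hu n z))
    exact ⟨a, ha⟩
  choose v hv using hlim
  refine ⟨v, hv, mem_domE_of_sum_le fun S => ?_⟩
  have ht : Tendsto (fun n => ∑ p ∈ S, G.c p.1 p.2 * (u n p.1 - u n p.2) ^ 2) U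
      (𝓝 (∑ p ∈ S, G.c p.1 p.2 * (v p.1 - v p.2) ^ 2)) :=
    tendsto_finsetSum _ fun p _ => (((hv p.1).sub (hv p.2)).pow 2).const_mul _
  refine le_of_tendsto ht ?_
  -- A finite set of pairs is eventually inside `W n ×ˢ W n`, so its energy sum is controlled by the
  -- local energy.
  have hS : ∀ᶠ n in (U : Filter ℕ), ∀ p ∈ S, p ∈ W n ×ˢ W n := by
    refine hU ((eventually_all_finset S).2 fun p _ => ?_)
    filter_upwards [hW.eventually_mem p.1, hW.eventually_mem p.2] with n h1 h2
    exact Finset.mem_product.2 ⟨h1, h2⟩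
  filter_upwards [hS, hb] with n hn hbn
  have := Finset.sum_le_sum_of_subset_of_nonneg (f := fun p => G.c p.1 p.2 *
    (u n p.1 - u n p.2) ^ 2) hn fun p _ _ => energy_term_nonneg (u n) p
  rw [localEnergy] at hbn
  linarith

/-- The free effective resistance is the resistance of the form on all functions of finite
energy. -/
theorem isFreeEffectiveResistance_resistance_domE (hconn : G.Connected)
    (hfin : G.LocallyFinite) :
    IsFreeEffectiveResistance G (resistance G.energyForm G.domE) := by
  intro W hW hWc x y
  have h := isResistanceForm_domE hconn hfin
  rcases eq_or_ne x y with rfl | hxy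
  · rw [resistance_self]
    refine tendsto_const_nhds.congr fun n => ?_
    split_ifs with hx
    · exact (effectiveResistance_self (hWc n) _).symm
    · rfl
  have hne := h.energies_nonempty hxy
  set S : ℕ → Set ℝ := fun n =>
    {r | ∃ u : V → ℝ, u x = 1 ∧ u y = 0 ∧ r = G.localEnergy (W n) u} with hS
  set m := sInf {r : ℝ | ∃ u ∈ G.domE, u x = 1 ∧ u y = 0 ∧ r = G.energyForm u u} with hm
  have hSb : ∀ n, BddBelow (S n) := fun n =>
    ⟨0, by rintro r ⟨u, -, -, rfl⟩; exact localEnergy_nonneg _ _⟩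
  have hSne : ∀ n, (S n).Nonempty := by
    obtain ⟨-, u, -, hx, hy, -⟩ := hne
    exact fun n => ⟨_, u, hx, hy, rfl⟩
  have hle : ∀ n, sInf (S n) ≤ m := by
    refine fun n => le_csInf hne ?_
    rintro r ⟨u, hu, hx, hy, rfl⟩
    exact (csInf_le (hSb n) ⟨u, hx, hy, rfl⟩).trans (localEnergy_le_energyForm _ hu)
  have ht : Tendsto (fun n => sInf (S n)) atTop (𝓝 m) := by
    rw [tendsto_order]
    refine ⟨fun a ha => ?_, fun a ha => Eventually.of_forall fun n => (hle n).trans_lt ha⟩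
    by_contra hcon
    have hfr : ∃ᶠ n in atTop, sInf (S n) ≤ a := by
      simpa only [not_eventually, not_lt] using hcon
    obtain ⟨b, hab, hbm⟩ := exists_between ha
    have hex : ∀ n, ∃ u : V → ℝ, (∀ z, u z ∈ Set.Icc (0 : ℝ) 1) ∧
        (sInf (S n) ≤ a → u x = 1 ∧ u y = 0 ∧ G.localEnergy (W n) u ≤ b) := by
      intro n
      by_cases hn : sInf (S n) ≤ a
      · obtain ⟨r, ⟨u, hx, hy, rfl⟩, hr⟩ := exists_lt_of_csInf_lt (hSne n) (hn.trans_lt hab)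
        refine ⟨clamp u, clamp_mem_Icc u, fun _ => ⟨?_, ?_, ?_⟩⟩
        · rw [clamp, hx]; norm_num
        · rw [clamp, hy]; norm_num
        · exact (localEnergy_clamp_le _ u).trans hr.le
      · exact ⟨fun _ => 0, by simp, fun h => absurd h hn⟩
    choose u hu01 hu using hex
    have hnb := frequently_iff_neBot.1 hfr
    -- An ultrafilter concentrated on the indices with infimum at most `a`. The limit of the
    -- truncated competitors along it is admissible with energy at most `b < m`, a contradiction.
    set U := Ultrafilter.of (atTop ⊓ 𝓟 {n | sInf (S n) ≤ a}) with hUdef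
    have hU : (U : Filter ℕ) ≤ atTop ⊓ 𝓟 {n | sInf (S n) ≤ a} := Ultrafilter.of_le _
    have hUe : ∀ᶠ n in (U : Filter ℕ), sInf (S n) ≤ a := le_principal_iff.1 (hU.trans inf_le_right)
    obtain ⟨v, hv, hvd, hvb⟩ := exists_limit_of_localEnergy_le (G := G) (b := b) hW U
      (hU.trans inf_le_left) hu01 (hUe.mono fun n hn => (hu n hn).2.2)
    have hvx : v x = 1 := tendsto_nhds_unique (hv x)
      (tendsto_const_nhds.congr' (hUe.mono fun n hn => (hu n hn).1.symm))
    have hvy : v y = 0 := tendsto_nhds_unique (hv y)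
      (tendsto_const_nhds.congr' (hUe.mono fun n hn => (hu n hn).2.1.symm))
    have := csInf_le (h.energies_bddBelow x y) ⟨v, hvd, hvx, hvy, rfl⟩
    linarith
  refine (ht.inv₀ (h.sInf_energies_pos hxy).ne').congr' ?_
  filter_upwards [hW.eventually_mem x, hW.eventually_mem y] with n hx hy
  rw [dif_pos ⟨hx, hy⟩, effectiveResistance_induce _ (hWc n)]

end WeightedGraph

/-! ### Finite functions and their energy closure -/

section FiniteFunctions

variable {V : Type*} {u v : V → ℝ}

theorem const_mem_finiteFunctions (k : ℝ) : (fun _ => k) ∈ finiteFunctions V :=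
  ⟨k, ∅, fun _ _ => rfl⟩

theorem add_mem_finiteFunctions (hu : u ∈ finiteFunctions V) (hv : v ∈ finiteFunctions V) :
    u + v ∈ finiteFunctions V := by
  classical
  obtain ⟨k, W, hW⟩ := hu
  obtain ⟨l, W', hW'⟩ := hv
  refine ⟨k + l, W ∪ W', fun x hx => ?_⟩
  rw [Finset.mem_union, not_or] at hx
  rw [Pi.add_apply, hW x hx.1, hW' x hx.2]

theorem smul_mem_finiteFunctions (a : ℝ) (hu : u ∈ finiteFunctions V) :
    a • u ∈ finiteFunctions V := by
  obtain ⟨k, W, hW⟩ := hu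
  exact ⟨a * k, W, fun x hx => by rw [Pi.smul_apply, hW x hx, smul_eq_mul]⟩

theorem clamp_mem_finiteFunctions (hu : u ∈ finiteFunctions V) :
    clamp u ∈ finiteFunctions V := by
  obtain ⟨k, W, hW⟩ := hu
  exact ⟨min 1 (max k 0), W, fun x hx => by rw [clamp, hW x hx]⟩

theorem single_mem_finiteFunctions [DecidableEq V] (y : V) :
    (Pi.single y 1 : V → ℝ) ∈ finiteFunctions V :=
  ⟨0, {y}, fun x hx => by simp only [Finset.mem_singleton] at hx; simp [hx]⟩

end FiniteFunctions

namespace WeightedGraph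

variable {V : Type*} {G : WeightedGraph V}

/-- Truncation is continuous for the energy, along pointwise convergent sequences. -/
theorem tendsto_energyForm_clamp_sub {w : ℕ → V → ℝ} {u : V → ℝ} (hw : ∀ n, w n ∈ G.domE)
    (hu : u ∈ G.domE) (hp : ∀ z, Tendsto (fun n => w n z) atTop (𝓝 (u z)))
    (ht : Tendsto (fun n => G.energyForm (w n - u) (w n - u)) atTop (𝓝 0)) :
    Tendsto (fun n => G.energyForm (clamp (w n) - clamp u) (clamp (w n) - clamp u)) atTop
      (𝓝 0) := by
  set g : ℕ → V × V → ℝ := fun n p => G.c p.1 p.2 * ((w n - u) p.1 - (w n - u) p.2) ^ 2 with hg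
  set k : ℕ → V × V → ℝ := fun n p => G.c p.1 p.2 *
    ((clamp (w n) - clamp u) p.1 - (clamp (w n) - clamp u) p.2) ^ 2 with hk
  -- Truncation need not contract energy distances, so `k n` is not simply bounded by `g n`. With
  -- $a$, $b$ the increments of $u$, $w_n$, the term `k n` is at most $2a^2+2b^2\le4(b-a)^2+6a^2$
  -- times the weight. So the excess over `4 * g n` has a majorant independent of `n` and sums to
  -- zero in the limit.
  set f : ℕ → V × V → ℝ := fun n p => max 0 (k n p - 4 * g n p) with hf
  have hgs : ∀ n, Summable (g n) := fun n => sub_mem_domE (hw n) hu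
  have hks : ∀ n, Summable (k n) := fun n => sub_mem_domE (clamp_mem_domE (hw n))
    (clamp_mem_domE hu)
  have hbs : Summable fun p : V × V => 6 * (G.c p.1 p.2 * (u p.1 - u p.2) ^ 2) :=
    Summable.mul_left 6 hu
  have hfb : ∀ n p, f n p ≤ 6 * (G.c p.1 p.2 * (u p.1 - u p.2) ^ 2) := by
    intro n p
    have hc := G.nonneg p.1 p.2
    refine max_le (mul_nonneg (by norm_num) (energy_term_nonneg u p)) ?_
    have h1 := clamp_sub_sq_le (w n) p.1 p.2
    have h2 := clamp_sub_sq_le u p.1 p.2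
    have h3 : ((clamp (w n) p.1 - clamp u p.1) - (clamp (w n) p.2 - clamp u p.2)) ^ 2 -
        4 * ((w n p.1 - u p.1) - (w n p.2 - u p.2)) ^ 2 ≤ 6 * (u p.1 - u p.2) ^ 2 := by
      nlinarith [sq_nonneg ((clamp (w n) p.1 - clamp (w n) p.2) + (clamp u p.1 - clamp u p.2)),
        sq_nonneg ((w n p.1 - w n p.2) - 2 * (u p.1 - u p.2))]
    have := mul_le_mul_of_nonneg_left h3 hc
    simp only [hk, hg, Pi.sub_apply]
    linarith
  have hfs : ∀ n, Summable (f n) := fun n =>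
    Summable.of_nonneg_of_le (fun p => le_max_left _ _) (hfb n) hbs
  have hclamp : ∀ z, Tendsto (fun n => clamp (w n) z) atTop (𝓝 (clamp u z)) := fun z =>
    tendsto_const_nhds.min ((hp z).max tendsto_const_nhds)
  have hft : Tendsto (fun n => ∑' p, f n p) atTop (𝓝 (∑' _ : V × V, (0 : ℝ))) := by
    refine tendsto_tsum_of_dominated_convergence hbs (fun p => ?_)
      (Eventually.of_forall fun n p => ?_)
    · have h1 : ∀ (a : ℕ → V → ℝ) (b : V → ℝ), (∀ z, Tendsto (fun n => a n z) atTop (𝓝 (b z))) →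
          Tendsto (fun n => G.c p.1 p.2 * ((a n - b) p.1 - (a n - b) p.2) ^ 2) atTop (𝓝 0) := by
        intro a b hab
        have := ((((hab p.1).sub_const (b p.1)).sub ((hab p.2).sub_const (b p.2))).pow 2).const_mul
          (G.c p.1 p.2)
        simpa using this
      have h2 := (tendsto_const_nhds (x := (0 : ℝ))).max
        ((h1 (fun n => clamp (w n)) (clamp u) hclamp).sub ((h1 w u hp).const_mul 4))
      simpa [hf, hk, hg] using h2
    · rw [Real.norm_of_nonneg (le_max_left _ _)]
      exact hfb n p
  rw [tsum_zero] at hft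
  refine squeeze_zero (fun n => energyForm_self_nonneg _) (fun n => ?_)
    (by simpa using (hft.const_mul (1 / 2)).add (ht.const_mul 4))
  have h1 : ∑' p, k n p ≤ ∑' p, f n p + 4 * ∑' p, g n p := by
    rw [← tsum_mul_left, ← (hfs n).tsum_add ((hgs n).mul_left 4)]
    refine Summable.tsum_le_tsum (fun p => ?_) (hks n) ((hfs n).add ((hgs n).mul_left 4))
    have := le_max_right 0 (k n p - 4 * g n p)
    simp only [hf]
    linarith
  rw [energyForm_self, energyForm_self]
  linarith

/-- The closure of the finite functions in the functions of finite energy. -/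
def finClosure (G : WeightedGraph V) : Set (V → ℝ) :=
  {u | u ∈ G.domE ∧ ∃ v : ℕ → V → ℝ, (∀ n, v n ∈ finiteFunctions V) ∧
    Tendsto (fun n => G.energyForm (v n - u) (v n - u)) atTop (𝓝 0)}

theorem finClosure_subset_domE : G.finClosure ⊆ G.domE := fun _ hu => hu.1

theorem finiteFunctions_subset_finClosure (hfin : G.LocallyFinite) :
    finiteFunctions V ⊆ G.finClosure := fun u hu =>
  ⟨finiteFunctions_subset_domE hfin hu, fun _ => u, fun _ => hu, by simp [energyForm]⟩

/-- The limit exists in `domE`; approximating the `n`-th term by a finite function up to `1 / (n +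
1)` keeps it in the closure. -/
theorem finClosure_complete (hconn : G.Connected) (hfin : G.LocallyFinite) (u : ℕ → V → ℝ)
    (hu : ∀ n, u n ∈ G.finClosure)
    (hc : ∀ ε > 0, ∃ N, ∀ m ≥ N, ∀ n ≥ N, G.energyForm (u m - u n) (u m - u n) < ε) :
    ∃ v ∈ G.finClosure, Tendsto (fun n => G.energyForm (u n - v) (u n - v)) atTop (𝓝 0) := by
  have h := isResistanceForm_domE hconn hfin
  have hFd := finiteFunctions_subset_domE hfin
  obtain ⟨v, hv, hvt⟩ := h.complete u (fun n => (hu n).1) hc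
  refine ⟨v, ⟨hv, ?_⟩, hvt⟩
  have hex : ∀ n : ℕ, ∃ w ∈ finiteFunctions V,
      G.energyForm (w - u n) (w - u n) < 1 / ((n : ℝ) + 1) := by
    intro n
    obtain ⟨-, w, hw, hwt⟩ := hu n
    obtain ⟨i, hi⟩ := (hwt.eventually (gt_mem_nhds (Nat.one_div_pos_of_nat (n := n)))).exists
    exact ⟨w i, hw i, hi⟩
  choose w hw hwu using hex
  refine ⟨w, hw, ?_⟩
  have hlim := ((tendsto_one_div_add_atTop_nhds_zero_nat (𝕜 := ℝ)).const_mul 2).add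
    (hvt.const_mul 2)
  rw [mul_zero, add_zero] at hlim
  refine squeeze_zero (fun n => energyForm_self_nonneg _) (fun n => ?_) hlim
  have := h.energy_add_le (sub_mem_domE (hFd (hw n)) (hu n).1) (sub_mem_domE (hu n).1 hv)
  rw [sub_add_sub_cancel] at this
  linarith [hwu n]

theorem clamp_mem_finClosure (hconn : G.Connected) (hfin : G.LocallyFinite) {u : V → ℝ}
    (hu : u ∈ G.finClosure) : clamp u ∈ G.finClosure := by
  have h := isResistanceForm_domE hconn hfin
  have hFd := finiteFunctions_subset_domE hfin
  obtain ⟨hud, v, hv, hvt⟩ := hu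
  obtain ⟨o⟩ := hconn.nonempty
  -- Added constants do not change the energy, and agreement with `u` at `o` upgrades energy
  -- convergence to the pointwise convergence that truncation requires.
  set w : ℕ → V → ℝ := fun n => v n + fun _ => u o - v n o with hw
  have hwF : ∀ n, w n ∈ finiteFunctions V := fun n =>
    add_mem_finiteFunctions (hv n) (const_mem_finiteFunctions _)
  have hwt : Tendsto (fun n => G.energyForm (w n - u) (w n - u)) atTop (𝓝 0) := by
    refine hvt.congr fun n => ?_
    rw [hw, add_sub_right_comm, h.energy_add_const _ (sub_mem_domE (hFd (hv n)) hud)]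
  refine ⟨clamp_mem_domE hud, fun n => clamp (w n), fun n => clamp_mem_finiteFunctions (hwF n),
    tendsto_energyForm_clamp_sub (fun n => hFd (hwF n)) hud (fun z => ?_) hwt⟩
  have h1 := (h.tendsto_sub_of_tendsto_energy (fun n => hFd (hwF n)) hud hwt z o).add_const (u o)
  simpa [hw] using h1

/-- The energy form on the closure of the finite functions is a resistance form. -/
theorem isResistanceForm_finClosure (hconn : G.Connected) (hfin : G.LocallyFinite) :
    IsResistanceForm G.energyForm G.finClosure := by
  have h := isResistanceForm_domE hconn hfin
  have hFd := finiteFunctions_subset_domE hfin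
  exact {
    const_mem := fun k => finiteFunctions_subset_finClosure hfin (const_mem_finiteFunctions k)
    add_mem := by
      rintro u ⟨hu, v, hv, hvt⟩ u' ⟨hu', v', hv', hvt'⟩
      refine ⟨add_mem_domE hu hu', fun n => v n + v' n,
        fun n => add_mem_finiteFunctions (hv n) (hv' n), ?_⟩
      refine squeeze_zero (fun n => energyForm_self_nonneg _) (fun n => ?_)
        (by simpa using (hvt.const_mul 2).add (hvt'.const_mul 2))
      rw [add_sub_add_comm]
      exact h.energy_add_le (sub_mem_domE (hFd (hv n)) hu) (sub_mem_domE (hFd (hv' n)) hu')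
    smul_mem := by
      rintro a u ⟨hu, v, hv, hvt⟩
      refine ⟨smul_mem_domE a hu, fun n => a • v n, fun n => smul_mem_finiteFunctions a (hv n), ?_⟩
      have := hvt.const_mul (a ^ 2)
      rw [mul_zero] at this
      refine this.congr fun n => ?_
      rw [← smul_sub, h.energy_smul a (sub_mem_domE (hFd (hv n)) hu)]
    map_add := fun u hu v hv w hw => h.map_add u hu.1 v hv.1 w hw.1
    map_smul := fun a u hu v hv => h.map_smul a u hu.1 v hv.1
    map_symm := fun u hu v hv => h.map_symm u hu.1 v hv.1
    map_nonneg := fun u hu => h.map_nonneg u hu.1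
    map_eq_zero_iff := fun u hu => h.map_eq_zero_iff u hu.1
    complete := finClosure_complete hconn hfin
    extend := by
      classical
      exact fun W v => ⟨fun x => if x ∈ W then v x else 0,
        finiteFunctions_subset_finClosure hfin ⟨0, W, fun x hx => if_neg hx⟩,
        fun x hx => if_pos hx⟩
    bounded := fun p q => (h.bounded p q).imp fun C hC u hu => hC u hu.1
    markov := fun u hu => ⟨clamp_mem_finClosure hconn hfin hu, energyForm_clamp_le hu.1⟩ }

theorem sInf_energies_finiteFunctions (hconn : G.Connected) (hfin : G.LocallyFinite) {x y : V}
    (hxy : x ≠ y) :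
    sInf {r : ℝ | ∃ u ∈ finiteFunctions V, u x = 1 ∧ u y = 0 ∧ r = G.energyForm u u} =
      sInf {r : ℝ | ∃ u ∈ G.finClosure, u x = 1 ∧ u y = 0 ∧ r = G.energyForm u u} := by
  classical
  have h := isResistanceForm_domE hconn hfin
  have hFd := finiteFunctions_subset_domE hfin
  have hb : BddBelow
      {r : ℝ | ∃ u ∈ finiteFunctions V, u x = 1 ∧ u y = 0 ∧ r = G.energyForm u u} :=
    ⟨0, by rintro r ⟨u, -, -, -, rfl⟩; exact energyForm_self_nonneg u⟩
  refine le_antisymm ?_ ?_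
  · refine le_csInf ((isResistanceForm_finClosure hconn hfin).energies_nonempty hxy) ?_
    rintro r ⟨u, ⟨hu, v, hv, hvt⟩, hx, hy, rfl⟩
    have hs := single_mem_domE hfin x
    -- Approximants need not take the values 1 and 0 at `x` and `y`. A constant repairs `y`, and `d
    -- n` times a point mass repairs `x`; as `d n` tends to 0, the energy limit is unaffected.
    set d : ℕ → ℝ := fun n => 1 - (v n x - v n y) with hd
    set w : ℕ → V → ℝ := fun n => (v n + fun _ => -v n y) + d n • Pi.single x 1 with hw
    have hwF : ∀ n, w n ∈ finiteFunctions V := fun n =>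
      add_mem_finiteFunctions (add_mem_finiteFunctions (hv n) (const_mem_finiteFunctions _))
        (smul_mem_finiteFunctions _ (single_mem_finiteFunctions x))
    have hdt : Tendsto d atTop (𝓝 0) := by
      have := (tendsto_const_nhds (x := (1 : ℝ))).sub
        (h.tendsto_sub_of_tendsto_energy (fun n => hFd (hv n)) hu hvt x y)
      simpa [hx, hy] using this
    have hwt : Tendsto (fun n => G.energyForm (w n - u) (w n - u)) atTop (𝓝 0) := by
      refine squeeze_zero (fun n => energyForm_self_nonneg _) (fun n => ?_)
        (by simpa using (hvt.const_mul 2).add (((hdt.pow 2).mul_const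
          (G.energyForm (Pi.single x 1) (Pi.single x 1))).const_mul 2))
      have hvu := sub_mem_domE (hFd (hv n)) hu
      have h1 := h.energy_add_le (add_mem_domE hvu (const_mem_domE (-v n y)))
        (smul_mem_domE (d n) hs)
      rw [h.energy_add_const _ hvu, h.energy_smul _ hs] at h1
      refine le_trans (le_of_eq ?_) h1
      have e : w n - u = (v n - u + fun _ => -v n y) + d n • Pi.single x 1 := by
        rw [hw, add_sub_right_comm, add_sub_right_comm]
      rw [e]
    refine ge_of_tendsto' (h.tendsto_energy (fun n => hFd (hwF n)) hu hwt) fun n =>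
      csInf_le hb ⟨w n, hwF n, ?_, ?_, rfl⟩
    · simp [hw, hd]
      ring
    · simp [hw, hxy.symm]
  · refine csInf_le_csInf ((isResistanceForm_finClosure hconn hfin).energies_bddBelow x y)
      ⟨_, Pi.single x 1, single_mem_finiteFunctions x, by simp, by simp [hxy.symm], rfl⟩ ?_
    rintro r ⟨u, hu, hr⟩
    exact ⟨u, finiteFunctions_subset_finClosure hfin hu, hr⟩

theorem resistance_finiteFunctions (hconn : G.Connected) (hfin : G.LocallyFinite) :
    resistance G.energyForm (finiteFunctions V) = resistance G.energyForm G.finClosure := by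
  ext x y
  rcases eq_or_ne x y with rfl | hxy
  · rw [resistance_self, resistance_self]
  · rw [resistance, resistance, sInf_energies_finiteFunctions hconn hfin hxy]

/-! ### Wired graphs and the wired effective resistance -/

/-- The extension to all vertices of a function on the wired graph. -/
noncomputable def wiredExtension [DecidableEq V] {W : Finset V} (v : Option W → ℝ) : V → ℝ :=
  fun z => if h : z ∈ W then v (some ⟨z, h⟩) else v none

theorem wiredExtension_coe [DecidableEq V] {W : Finset V} (v : Option W → ℝ) (z : W) :
    wiredExtension v z = v (some z) :=
  dif_pos z.2

theorem wiredExtension_of_notMem [DecidableEq V] {W : Finset V} (v : Option W → ℝ) {z : V}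
    (hz : z ∉ W) : wiredExtension v z = v none :=
  dif_neg hz

theorem wiredExtension_mem_finiteFunctions [DecidableEq V] {W : Finset V} (v : Option W → ℝ) :
    wiredExtension v ∈ finiteFunctions V :=
  ⟨v none, W, fun _ hz => wiredExtension_of_notMem v hz⟩

/-- The extension is constant off `W`, so that part of the row collapses to the single edge to
`none`. -/
theorem hasSum_wiredExtension [DecidableEq V] (hfin : G.LocallyFinite) {W : Finset V}
    (v : Option W → ℝ) (y : W) :
    HasSum (fun z => G.c y z * (wiredExtension v y - wiredExtension v z))
      ((G.wire W).combLaplacian v (some y)) := by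
  have h1 : HasSum ((fun z => G.c y z * (wiredExtension v y - wiredExtension v z)) ∘
      ((↑) : {z // z ∈ W} → V)) (∑ z : W, G.c y z * (v (some y) - v (some z))) := by
    have := hasSum_fintype fun z : W => G.c y z * (v (some y) - v (some z))
    refine this.congr_fun ?_
    intro z
    simp only [Function.comp_apply, wiredExtension_coe]
  have h2 : HasSum ((fun z => G.c y z * (wiredExtension v y - wiredExtension v z)) ∘
      ((↑) : {z // z ∉ W} → V)) ((∑' z : {z // z ∉ W}, G.c y z) * (v (some y) - v none)) := by
    have := ((hfin y).subtype {z | z ∉ W}).hasSum.mul_right (v (some y) - v none)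
    refine this.congr_fun ?_
    rintro ⟨z, hz⟩
    simp only [Function.comp_apply, wiredExtension_coe, wiredExtension_of_notMem v hz]
  have h3 := HasSum.add_isCompl (s := {z | z ∈ W}) (t := {z | z ∉ W}) isCompl_compl h1 h2
  convert h3 using 1
  rw [combLaplacian, Fintype.sum_option, add_comm]
  rfl

/-- The energy on the wired graph. -/
theorem energyForm_wire [DecidableEq V] (hconn : G.Connected) (hfin : G.LocallyFinite)
    {W : Finset V} (v : Option W → ℝ) :
    (G.wire W).energyForm v v = G.energyForm (wiredExtension v) (wiredExtension v) := by
  have h := isResistanceForm_domE hconn hfin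
  have hud := finiteFunctions_subset_domE hfin (wiredExtension_mem_finiteFunctions v)
  have e : wiredExtension v = ((∑ y : W, (v (some y) - v none) • (Pi.single (y : V) 1 : V → ℝ)) +
      fun _ => v none) := by
    ext z
    simp only [Pi.add_apply, Finset.sum_apply, Pi.smul_apply, smul_eq_mul]
    by_cases hz : z ∈ W
    · rw [Finset.sum_eq_single ⟨z, hz⟩]
      · simp [wiredExtension, hz]
      · intro y _ hy
        rw [Pi.single_apply, if_neg fun e => hy (Subtype.ext e.symm), mul_zero]
      · simp
    · rw [Finset.sum_eq_zero, zero_add, wiredExtension_of_notMem v hz]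
      intro y _
      rw [Pi.single_apply, if_neg fun e : z = y => hz (e ▸ y.2), mul_zero]
  have hsum := sum_combLaplacian (G.wire W) v
  rw [Fintype.sum_option] at hsum
  have hs : ∀ y : W, (Pi.single (y : V) 1 : V → ℝ) ∈ G.domE := fun y => single_mem_domE hfin _
  conv_rhs => arg 3; rw [e]
  rw [h.map_add_right (h.sum_smul_mem _ _ hs) (h.const_mem _) hud,
    h.map_sum_smul_right _ _ hs hud, energyForm_comm _ (fun _ => v none),
    h.map_const_left _ hud, energyForm_eq_sum_combLaplacian, Fintype.sum_option]
  simp only [energyForm_single (hasSum_wiredExtension hfin v _), sub_mul,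
    Finset.sum_sub_distrib, ← Finset.mul_sum]
  -- Pairing with point masses sees only the vertices of `W`; the term at `none` is recovered
  -- because Laplacians sum to zero.
  linear_combination v none * hsum

/-- As `V` is infinite, some vertex lies outside `W`, so `v none` is a value of the extension, which
is constant when its energy is zero. -/
theorem wire_connected [Infinite V] (hconn : G.Connected) (hfin : G.LocallyFinite)
    (W : Finset V) : (G.wire W).Connected := by
  classical
  refine connected_of_energyForm_eq_zero fun v hv => ?_
  rw [energyForm_wire hconn hfin] at hv
  have hud := finiteFunctions_subset_domE hfin (wiredExtension_mem_finiteFunctions v)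
  obtain ⟨o, ho⟩ := Infinite.exists_notMem_finset W
  have key : ∀ x, v x = v none := by
    rintro (_ | x)
    · rfl
    · rw [← wiredExtension_coe v x, ← wiredExtension_of_notMem v ho]
      exact eq_const_of_energyForm_eq_zero hconn hud hv _ _
  exact fun x y => (key x).trans (key y).symm

/-- The wired effective resistance is the resistance given by the finite functions. -/
theorem isWiredEffectiveResistance_resistance_finiteFunctions [Infinite V] (hconn : G.Connected)
    (hfin : G.LocallyFinite) :
    IsWiredEffectiveResistance G (resistance G.energyForm (finiteFunctions V)) := by
  classical
  intro W hW _ x y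
  rcases eq_or_ne x y with rfl | hxy
  · rw [resistance_self]
    refine tendsto_const_nhds.congr fun n => ?_
    split_ifs with hx
    · exact (effectiveResistance_self (wire_connected hconn hfin _) _).symm
    · rfl
  have hpos := (isResistanceForm_finClosure hconn hfin).sInf_energies_pos hxy
  rw [← sInf_energies_finiteFunctions hconn hfin hxy] at hpos
  set S := {r : ℝ | ∃ u ∈ finiteFunctions V, u x = 1 ∧ u y = 0 ∧ r = G.energyForm u u} with hS
  have hSb : BddBelow S := ⟨0, by rintro r ⟨u, -, -, -, rfl⟩; exact energyForm_self_nonneg u⟩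
  have hSne : S.Nonempty :=
    ⟨_, Pi.single x 1, single_mem_finiteFunctions x, by simp, by simp [hxy.symm], rfl⟩
  set m : ℕ → ℝ := fun n => if h : x ∈ W n ∧ y ∈ W n then
    sInf {r : ℝ | ∃ v ∈ (Set.univ : Set (Option (W n) → ℝ)), v (some ⟨x, h.1⟩) = 1 ∧
      v (some ⟨y, h.2⟩) = 0 ∧ r = (G.wire (W n)).energyForm v v} else 0 with hm
  -- Wired competitors extend to finite functions, which bounds `m n` below; conversely, a finite
  -- function is a wired competitor once `W n` contains its exceptional set.
  have ht : Tendsto m atTop (𝓝 (sInf S)) := by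
    rw [tendsto_order]
    constructor
    · intro a ha
      filter_upwards [hW.eventually_mem x, hW.eventually_mem y] with n hx hy
      refine ha.trans_le ?_
      simp only [hm]
      rw [dif_pos ⟨hx, hy⟩]
      refine le_csInf ((isResistanceForm_univ (wire_connected hconn hfin (W n))).energies_nonempty
        (by simpa using hxy)) ?_
      rintro r ⟨v, -, hvx, hvy, rfl⟩
      rw [energyForm_wire hconn hfin]
      exact csInf_le hSb ⟨wiredExtension v, wiredExtension_mem_finiteFunctions v,
        (wiredExtension_coe v ⟨x, hx⟩).trans hvx, (wiredExtension_coe v ⟨y, hy⟩).trans hvy, rfl⟩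
    · intro a ha
      obtain ⟨r, ⟨u, ⟨k, W₀, hk⟩, hux, huy, rfl⟩, hr⟩ := exists_lt_of_csInf_lt hSne ha
      have hW₀ : ∀ᶠ n in atTop, ∀ z ∈ W₀, z ∈ W n :=
        (eventually_all_finset W₀).2 fun z _ => hW.eventually_mem z
      filter_upwards [hW.eventually_mem x, hW.eventually_mem y, hW₀] with n hx hy hn
      refine lt_of_le_of_lt ?_ hr
      simp only [hm]
      rw [dif_pos ⟨hx, hy⟩]
      let v : Option (W n) → ℝ := fun o => o.elim k fun z => u z
      have hv : wiredExtension v = u := by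
        ext z
        by_cases hz : z ∈ W n
        · exact wiredExtension_coe v ⟨z, hz⟩
        · rw [wiredExtension_of_notMem v hz, hk z fun h => hz (hn z h)]
          rfl
      refine csInf_le ((isResistanceForm_univ
        (wire_connected hconn hfin (W n))).energies_bddBelow _ _) ⟨v, trivial, hux, huy, ?_⟩
      rw [energyForm_wire hconn hfin, hv]
  refine (ht.inv₀ hpos.ne').congr' ?_
  filter_upwards [hW.eventually_mem x, hW.eventually_mem y] with n hx hy
  simp only [hm]
  rw [dif_pos ⟨hx, hy⟩, dif_pos ⟨hx, hy⟩,
    effectiveResistance_eq_resistance (wire_connected hconn hfin (W n)), resistance]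

end WeightedGraph

theorem mainTheorem4 {V : Type*} [Countable V] [Infinite V] (G : WeightedGraph V)
    (hconn : G.Connected) (hfin : G.LocallyFinite) :
    -- every admissible domain gives back the graph
    (∀ D : Set (V → ℝ), finiteFunctions V ⊆ D → D ⊆ G.domE →
      IsResistanceForm G.energyForm D → IsLimitGraph (resistance G.energyForm D) G) ∧
    -- the free effective resistance is covered, by the domain `dom E`
    (∃ R : V → V → ℝ, IsFreeEffectiveResistance G R ∧
      finiteFunctions V ⊆ G.domE ∧ IsResistanceForm G.energyForm G.domE ∧
      R = resistance G.energyForm G.domE ∧ IsLimitGraph R G) ∧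
    -- the wired effective resistance, an infimum over `Fin`, is covered as well
    (∃ R : V → V → ℝ, IsWiredEffectiveResistance G R ∧
      R = resistance G.energyForm (finiteFunctions V) ∧
      (∃ D : Set (V → ℝ), finiteFunctions V ⊆ D ∧ D ⊆ G.domE ∧
        IsResistanceForm G.energyForm D ∧ R = resistance G.energyForm D) ∧
      IsLimitGraph R G) := by
  refine ⟨fun D hFD _ h => WeightedGraph.isLimitGraph_resistance hfin hFD h, ?_, ?_⟩
  · exact ⟨_, WeightedGraph.isFreeEffectiveResistance_resistance_domE hconn hfin,
      WeightedGraph.finiteFunctions_subset_domE hfin, WeightedGraph.isResistanceForm_domE hconn hfin, rfl,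
      WeightedGraph.isLimitGraph_resistance hfin (WeightedGraph.finiteFunctions_subset_domE hfin)
        (WeightedGraph.isResistanceForm_domE hconn hfin)⟩
  · have h := WeightedGraph.isResistanceForm_finClosure hconn hfin
    have hF := WeightedGraph.finiteFunctions_subset_finClosure hfin
    have hR := WeightedGraph.resistance_finiteFunctions hconn hfin
    refine ⟨_, WeightedGraph.isWiredEffectiveResistance_resistance_finiteFunctions hconn hfin,
      rfl, ⟨G.finClosure, hF, WeightedGraph.finClosure_subset_domE, h, hR⟩, ?_⟩
    rw [hR]
    exact WeightedGraph.isLimitGraph_resistance hfin hF h
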